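/- Let $X$ be a complex Banach space, $\mathbf T=(T_t)_{t\ge 0}$ a strongly continuous semigroup on $X$ with generator $A$, and write $R(\lambda)=(\lambda-A)^{-1}$ for $\lambda\in\rho(A)$. Let $\omega_0=\inf\{w\in\mathbb R:\exists M\ \forall t\ge0\ \|T_t\|\le Me^{wt}\}\in[-\infty,\infty)$ be the growth bound of $\mathbf T$, and let $\alpha\ge 0$. Fractional domains. Fix $\omega>\max\{\omega_0+3,3\}$ and $0<\theta<\pi/6$. Let $\gamma$ be the path formed by the two rays $-1+re^{-i\theta}$ and $-1+re^{i\theta}$ ($r\ge0$), run upwards, that is, from $\infty e^{-i\theta}$ to $-1$ and then to $\infty e^{i\theta}$. For $\alpha>0$ put $$A_\omega^{-\alpha}x=\frac1{2\pi i}\int_\gamma \mu^{-\alpha}R(\mu+\omega)x\,d\mu ,\qquad x\in X,$$ where $\mu^{-\alpha}$ is the branch with $\arg\mu\in(0,2\pi)$, and put $A_\omega^{0}=I$. Let $X_\alpha$ be the domain of $A_\omega^\alpha=(A_\omega^{-\alpha})^{-1}$, i.e. the range of $A_\omega^{-\alpha}$; so $X_0=X$. Let $s_\alpha(A)\in[-\infty,\infty)$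 be the infimum of all $s\in\mathbb R$ such that $\{\operatorname{Re}\lambda>s\}\subset\rho(A)$ and $$\sup\Big\{\frac{\|R(\lambda)\|}{1+|\operatorname{Im}\lambda|^{\alpha}}:\operatorname{Re}\lambda>s\Big\}<\infty .$$ Then for every $x\in X_\alpha$, every real $h>s_\alpha(A)$ and every $t\in\mathbb R$, $$F_t(x)=\frac1{2\pi i}\,(C,1)\!\int_{\operatorname{Re}\lambda=h}e^{\lambda t}R(\lambda)x\,d\lambda ,\qquad F_t(x)=\begin{cases}T_tx,&t>0,\\ \tfrac12x,&t=0,\\ 0,&t<0,\end{cases}$$ where $$(C,1)\!\int_{\operatorname{Re}\lambda=h}g(\lambda)\,d\lambda=\lim_{N\to\infty}\frac1N\int_0^N\int_{-l}^{l}g(h+is)\,i\,ds\,dl ;$$ in particular, this limit exists in the norm of $X$. -/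

import Mathlib

open Filter Topology MeasureTheory
open scoped NNReal

noncomputable section

/-- A strongly continuous semigroup `(T_t)_{t ≥ 0}` of bounded operators on `X`. -/
structure C0Semigroup (X : Type*) [NormedAddCommGroup X] [NormedSpace ℂ X] where
  /-- the operator `T_t` -/
  op : ℝ≥0 → X →L[ℂ] X
  op_zero : op 0 = ContinuousLinearMap.id ℂ X
  op_add : ∀ s t : ℝ≥0, op (s + t) = (op s).comp (op t)
  continuous_orbit : ∀ x : X, Continuous fun t : ℝ≥0 => op t x

namespace C0Semigroup

variable {X : Type*} [NormedAddCommGroup X] [NormedSpace ℂ X]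

/-- `y = lim_{t → 0+} (T_t x - x) / t`. -/
def HasGeneratorAt (T : C0Semigroup X) (x y : X) : Prop :=
  Tendsto (fun t : ℝ≥0 => ((t : ℝ)⁻¹ : ℂ) • (T.op t x - x)) (𝓝[>] 0) (𝓝 y)

theorem HasGeneratorAt.unique {T : C0Semigroup X} {x y z : X}
    (hy : T.HasGeneratorAt x y) (hz : T.HasGeneratorAt x z) : y = z :=
  tendsto_nhds_unique hy hz

theorem HasGeneratorAt.add {T : C0Semigroup X} {x y x' y' : X}
    (h : T.HasGeneratorAt x y) (h' : T.HasGeneratorAt x' y') :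
    T.HasGeneratorAt (x + x') (y + y') := by
  refine (Tendsto.add h h').congr fun t => ?_
  rw [← smul_add, map_add]
  congr 1
  abel

theorem HasGeneratorAt.smul {T : C0Semigroup X} {x y : X} (c : ℂ)
    (h : T.HasGeneratorAt x y) : T.HasGeneratorAt (c • x) (c • y) := by
  refine (Tendsto.const_smul h c).congr fun t => ?_
  rw [map_smul, ← smul_sub, smul_comm]

theorem hasGeneratorAt_zero (T : C0Semigroup X) : T.HasGeneratorAt 0 0 := by
  simp [HasGeneratorAt]

/-- The infinitesimal generator `A` of the semigroup, an unbounded operator on `X`: its domain is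
the set of all `x` for which `lim_{t → 0+} (T_t x - x) / t` exists, and `A x` is that limit. -/
def generator (T : C0Semigroup X) : X →ₗ.[ℂ] X where
  domain :=
    { carrier := {x | ∃ y, T.HasGeneratorAt x y}
      add_mem' := fun ⟨_, h⟩ ⟨_, h'⟩ => ⟨_, h.add h'⟩
      zero_mem' := ⟨0, T.hasGeneratorAt_zero⟩
      smul_mem' := fun c _ ⟨_, h⟩ => ⟨_, h.smul c⟩ }
  toFun :=
    { toFun := fun x => x.2.choose
      map_add' := fun x y =>
        (x + y).2.choose_spec.unique (x.2.choose_spec.add y.2.choose_spec)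
      map_smul' := fun c x =>
        (c • x).2.choose_spec.unique (x.2.choose_spec.smul c) }

/-- The growth bound `ω₀(T) = inf {w ∈ ℝ : ∃ M, ∀ t ≥ 0, ‖T_t‖ ≤ M e^{w t}}`, an extended real
number: it is `-∞` for instance for nilpotent semigroups. -/
def growthBound (T : C0Semigroup X) : EReal :=
  sInf ((fun w : ℝ => (w : EReal)) ''
    {w : ℝ | ∃ M : ℝ, ∀ t : ℝ≥0, ‖T.op t‖ ≤ M * Real.exp (w * t)})

/-- `F_t(x)` equals `T_t x` for `t > 0`, `x / 2` for `t = 0`, and `0` for `t < 0`. -/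
def extendedOrbit (T : C0Semigroup X) (t : ℝ) (x : X) : X :=
  if 0 < t then T.op t.toNNReal x else if t = 0 then (1 / 2 : ℂ) • x else 0

end C0Semigroup

namespace UnboundedOperator

variable {X : Type*} [NormedAddCommGroup X] [NormedSpace ℂ X]

/-- `R` is a bounded two-sided inverse of `z - A : D(A) → X`. -/
def IsResolventAt (A : X →ₗ.[ℂ] X) (z : ℂ) (R : X →L[ℂ] X) : Prop :=
  (∀ x : X, ∃ h : R x ∈ A.domain, z • R x - A ⟨R x, h⟩ = x) ∧
    ∀ x : A.domain, R (z • (x : X) - A x) = x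

/-- The resolvent set `ρ(A)`. -/
def resolventSet (A : X →ₗ.[ℂ] X) : Set ℂ :=
  {z | ∃ R : X →L[ℂ] X, IsResolventAt A z R}

open Classical in
/-- The resolvent `R(z) = (z - A)⁻¹` for `z ∈ ρ(A)` (and `0` for other `z`). -/
def resolvent (A : X →ₗ.[ℂ] X) (z : ℂ) : X →L[ℂ] X :=
  if h : ∃ R : X →L[ℂ] X, IsResolventAt A z R then h.choose else 0

/-- `s_α(A)`, the infimum of all real `s` such that the half plane `Re z > s` lies in `ρ(A)` and
`‖R(z)‖ / (1 + |Im z|^α)` is bounded on it; an extended real number. -/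
def resolventAbscissa (A : X →ₗ.[ℂ] X) (α : ℝ) : EReal :=
  sInf ((fun s : ℝ => (s : EReal)) ''
    {s : ℝ | (∀ z : ℂ, s < z.re → z ∈ resolventSet A) ∧
      ∃ C : ℝ, ∀ z : ℂ, s < z.re → ‖resolvent A z‖ / (1 + |z.im| ^ α) ≤ C})

/-- The branch of `μ^{-α}` that is holomorphic off `[0, ∞)`, with `arg μ ∈ (0, 2π)`. -/
def negPow (α : ℝ) (μ : ℂ) : ℂ :=
  Complex.exp (-α * (Complex.log (-μ) + Real.pi * Complex.I))

/-- The operator `A_ω^{-α}`, `A_ω = A - ω`. For `α > 0` it is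
`A_ω^{-α} x = (2πi)⁻¹ ∫_γ μ^{-α} R(μ + ω) x dμ`, where `γ` consists of the two rays
`-1 + r e^{-iθ}` and `-1 + r e^{iθ}`, `r ≥ 0`, and runs upwards: it comes in from infinity along
the first ray and leaves along the second. For `α = 0` it is the identity. -/
def fracNegPower (A : X →ₗ.[ℂ] X) (ω θ α : ℝ) (x : X) : X :=
  if α = 0 then x else
    (2 * Real.pi * Complex.I)⁻¹ •
      ((∫ r in Set.Ioi (0 : ℝ), Complex.exp (θ * Complex.I) •
          (negPow α (-1 + r * Complex.exp (θ * Complex.I)) •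
            resolvent A (-1 + r * Complex.exp (θ * Complex.I) + ω) x)) -
        ∫ r in Set.Ioi (0 : ℝ), Complex.exp (-θ * Complex.I) •
          (negPow α (-1 + r * Complex.exp (-θ * Complex.I)) •
            resolvent A (-1 + r * Complex.exp (-θ * Complex.I) + ω) x))

/-- The space `X_α`, as a set: the domain of `A_ω^α`, the inverse of `A_ω^{-α}`, hence the range
of `A_ω^{-α}`. -/
def fracDomain (A : X →ₗ.[ℂ] X) (ω θ α : ℝ) : Set X :=
  Set.range (fracNegPower A ω θ α)

end UnboundedOperator

/-- `J = (C,1) ∫_{Re z = h} g(z) dz`, that is, `g` is integrable on bounded segments of the line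
`Re z = h`, and `J = lim_{N → ∞} N⁻¹ ∫_0^N (∫_{-l}^l g(h + i s) i ds) dl` in norm. -/
def HasCesaroLineIntegral {X : Type*} [NormedAddCommGroup X] [NormedSpace ℂ X]
    (g : ℂ → X) (h : ℝ) (J : X) : Prop :=
  (∀ l : ℝ, IntervalIntegrable (fun s : ℝ => g (h + s * Complex.I)) volume (-l) l) ∧
    Tendsto (fun N : ℝ => N⁻¹ • ∫ l in (0 : ℝ)..N, ∫ s in (-l)..l,
      Complex.I • g (h + s * Complex.I)) atTop (𝓝 J)

end

noncomputable section

/-! To the right of the growth bound the resolvent is the Laplace transform of the orbit. On such a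
line `Re z = h` it is the Fourier transform of `u ↦ e^{-hu} T_u x`, cut off to `u > 0`, and the
(C,1) inversion formula is Fejér's theorem (`tendsto_cesaro_fourier`). Only the symmetric mean of
the function at `t` matters, hence the value `x/2` at the jump `t = 0`.

For smaller `h` the line `Re z = ω - 2` is moved to `Re z = h` by Cauchy's theorem
(`tendsto_cesaro_line_shift`). The horizontal sides vanish once `R(z)x → 0` as `|Im z| → ∞`,
uniformly in the strip. This is where `x ∈ X_α` enters
(`exists_norm_resolvent_le_of_mem_fracDomain`).

For `α > 0`, put `R(z)` under the integral defining `A_ω^{-α} y` and use `R(z)R(μ+ω) = (R(z) -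
R(μ+ω))/(μ+ω-z)`. Up to the factor `1/(2πi)`, the result is the scalar `∫_γ μ^{-α}/(μ+ω-z) dμ` times
`R(z)y`, minus an absolutely convergent integral bounded uniformly in `z`. The scalar is `O(|Im
z|^{-α})` (`exists_norm_rayIntegral_sub_le`), which cancels the growth `|Im z|^α` of `R(z)`. So
`R(z)A_ω^{-α}` is uniformly bounded far out in the strip. On the dense range of one fixed resolvent
it is `O(1/|Im z|)`, and density gives decay on every vector (`exists_norm_resolvent_comp_le`). -/

theorem integral_Ioi_comp_add_right {E : Type*} [NormedAddCommGroup E] [NormedSpace ℝ E]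
    (f : ℝ → E) (a t : ℝ) :
    ∫ u in Set.Ioi a, f (u + t) = ∫ u in Set.Ioi (a + t), f u := by
  have := (measurePreserving_add_right volume t).setIntegral_preimage_emb
    (measurableEmbedding_addRight t) f (Set.Ioi (a + t))
  simpa using this

/-! ### The Laplace transform of a semigroup is the resolvent of its generator. -/

namespace C0Semigroup

variable {X : Type*} [NormedAddCommGroup X] [NormedSpace ℂ X]

/-- The growth bound may be `-∞`, so the real constant is moved across the inequality in `EReal`
before an admissible exponent `w` is picked from the infimum. -/
theorem exists_bound_of_growthBound_add_lt {T : C0Semigroup X} {c ω : ℝ}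
    (h : T.growthBound + c < (ω : EReal)) :
    ∃ w M : ℝ, w + c < ω ∧ ∀ t : ℝ≥0, ‖T.op t‖ ≤ M * Real.exp (w * t) := by
  have h1 : T.growthBound < ((ω - c : ℝ) : EReal) := by
    rw [EReal.coe_sub]
    exact (EReal.lt_sub_iff_add_lt (by simp) (by simp)).2 h
  obtain ⟨_, ⟨w, ⟨M, hM⟩, rfl⟩, hw⟩ := sInf_lt_iff.1 h1
  have : w < ω - c := EReal.coe_lt_coe_iff.1 hw
  exact ⟨w, M, by linarith, hM⟩

theorem continuous_op_toNNReal (T : C0Semigroup X) (x : X) :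
    Continuous fun u : ℝ => T.op u.toNNReal x :=
  (T.continuous_orbit x).comp continuous_real_toNNReal

theorem bound_nonneg {T : C0Semigroup X} {M w : ℝ}
    (hM : ∀ t : ℝ≥0, ‖T.op t‖ ≤ M * Real.exp (w * t)) : 0 ≤ M := by
  simpa using (norm_nonneg _).trans (hM 0)

theorem norm_exp_smul_op_le {T : C0Semigroup X} {M w : ℝ}
    (hM : ∀ t : ℝ≥0, ‖T.op t‖ ≤ M * Real.exp (w * t)) (z : ℂ) (x : X) {u : ℝ} (hu : 0 ≤ u) :
    ‖Complex.exp (-(z * u)) • T.op u.toNNReal x‖ ≤ M * Real.exp ((w - z.re) * u) * ‖x‖ := by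
  rw [norm_smul, Complex.norm_exp]
  have h1 := (T.op u.toNNReal).le_of_opNorm_le (hM _) x
  rw [Real.coe_toNNReal u hu] at h1
  calc _ ≤ Real.exp (-(z * u)).re * (M * Real.exp (w * u) * ‖x‖) := by gcongr
    _ = M * (Real.exp (-(z.re * u)) * Real.exp (w * u)) * ‖x‖ := by
      simp only [Complex.neg_re, Complex.re_mul_ofReal]; ring
    _ = _ := by rw [← Real.exp_add]; ring_nf

theorem continuous_exp_smul_op (T : C0Semigroup X) (z : ℂ) (x : X) :
    Continuous fun u : ℝ => Complex.exp (-(z * u)) • T.op u.toNNReal x :=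
  Continuous.smul (by fun_prop) (T.continuous_op_toNNReal x)

theorem integrableOn_exp_smul_op {T : C0Semigroup X} {M w : ℝ}
    (hM : ∀ t : ℝ≥0, ‖T.op t‖ ≤ M * Real.exp (w * t)) {z : ℂ} (hz : w < z.re) (x : X) :
    IntegrableOn (fun u : ℝ => Complex.exp (-(z * u)) • T.op u.toNNReal x) (Set.Ioi 0) := by
  have h1 : IntegrableOn (fun u : ℝ => M * Real.exp ((w - z.re) * u) * ‖x‖) (Set.Ioi 0) :=
    ((integrableOn_exp_mul_Ioi (by linarith) 0).const_mul M).mul_const _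
  refine h1.mono' (T.continuous_exp_smul_op z x).aestronglyMeasurable ?_
  exact (ae_restrict_mem measurableSet_Ioi).mono fun u hu => norm_exp_smul_op_le hM z x (le_of_lt hu)

/-- The Laplace transform of the semigroup as a bounded operator. -/
def laplace {T : C0Semigroup X} {M w : ℝ}
    (hM : ∀ t : ℝ≥0, ‖T.op t‖ ≤ M * Real.exp (w * t)) {z : ℂ} (hz : w < z.re) : X →L[ℂ] X :=
  LinearMap.mkContinuous
    { toFun := fun x => ∫ u in Set.Ioi (0 : ℝ), Complex.exp (-(z * u)) • T.op u.toNNReal x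
      map_add' := fun x y => by
        rw [← integral_add (integrableOn_exp_smul_op hM hz x) (integrableOn_exp_smul_op hM hz y)]
        simp only [map_add, smul_add]
      map_smul' := fun c x => by
        rw [RingHom.id_apply, ← integral_smul]
        simp only [map_smul, smul_comm c] }
    (M / (z.re - w)) fun x => by
      have h1 : IntegrableOn (fun u : ℝ => M * Real.exp ((w - z.re) * u) * ‖x‖) (Set.Ioi 0) :=
        ((integrableOn_exp_mul_Ioi (by linarith) 0).const_mul M).mul_const _
      refine (norm_integral_le_of_norm_le h1 ((ae_restrict_mem measurableSet_Ioi).mono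
        fun u hu => norm_exp_smul_op_le hM z x (le_of_lt hu))).trans_eq ?_
      rw [integral_mul_const, integral_const_mul, integral_exp_mul_Ioi (by linarith)]
      have : z.re - w ≠ 0 := by linarith
      have : w - z.re ≠ 0 := by linarith
      simp only [mul_zero, Real.exp_zero]
      rw [← neg_sub z.re w, neg_div_neg_eq, mul_one_div]

section Laplace

variable {T : C0Semigroup X} {M w : ℝ} (hM : ∀ t : ℝ≥0, ‖T.op t‖ ≤ M * Real.exp (w * t))
  {z : ℂ} (hz : w < z.re)

theorem laplace_apply (x : X) :
    laplace hM hz x = ∫ u in Set.Ioi (0 : ℝ), Complex.exp (-(z * u)) • T.op u.toNNReal x := rfl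

theorem norm_laplace_le : ‖laplace hM hz‖ ≤ M / (z.re - w) :=
  LinearMap.mkContinuous_norm_le _ (div_nonneg (bound_nonneg hM) (by linarith)) _

theorem op_laplace [CompleteSpace X] (t : ℝ≥0) (x : X) :
    T.op t (laplace hM hz x) = laplace hM hz (T.op t x) := by
  rw [laplace_apply, laplace_apply,
    ← ContinuousLinearMap.integral_comp_comm _ (integrableOn_exp_smul_op hM hz x)]
  congr 1 with u
  rw [map_smul, ← ContinuousLinearMap.comp_apply, ← T.op_add, add_comm, T.op_add,
    ContinuousLinearMap.comp_apply]

/-- By the semigroup law the tail of the Laplace integral beyond `t` is `e^{-zt} T_t` applied to the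
whole integral. The generator of the Laplace transform and the density of its range are both read
off from this identity. -/
theorem intervalIntegral_exp_smul_op [CompleteSpace X] (t : ℝ≥0) (x : X) :
    ∫ u in (0 : ℝ)..t, Complex.exp (-(z * u)) • T.op u.toNNReal x =
      laplace hM hz x - Complex.exp (-(z * t)) • T.op t (laplace hM hz x) := by
  have h0 := integrableOn_exp_smul_op hM hz x
  have h1 : Complex.exp (-(z * t)) • T.op t (laplace hM hz x) =
      ∫ u in Set.Ioi (t : ℝ), Complex.exp (-(z * u)) • T.op u.toNNReal x := by
    rw [laplace_apply, ← ContinuousLinearMap.integral_comp_comm _ h0, ← integral_smul]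
    have h2 := integral_Ioi_comp_add_right
      (fun u : ℝ => Complex.exp (-(z * u)) • T.op u.toNNReal x) 0 (t : ℝ)
    rw [zero_add] at h2
    rw [← h2]
    refine setIntegral_congr_fun measurableSet_Ioi fun u hu => ?_
    have hu' : (0 : ℝ) ≤ u := le_of_lt hu
    rw [map_smul, smul_smul, ← Complex.exp_add, ← ContinuousLinearMap.comp_apply, ← T.op_add,
      Real.toNNReal_add hu' t.coe_nonneg, Real.toNNReal_coe, add_comm t]
    congr 2
    push_cast
    ring
  rw [h1, laplace_apply]
  exact (intervalIntegral.integral_Ioi_sub_Ioi h0 t.2).symm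

theorem hasGeneratorAt_laplace [CompleteSpace X] (x : X) :
    T.HasGeneratorAt (laplace hM hz x) (z • laplace hM hz x - x) := by
  set y := laplace hM hz x with hy
  have hexp : HasDerivAt (fun t : ℝ => Complex.exp (z * t)) z 0 := by
    have := ((Complex.ofRealCLM.hasDerivAt (x := 0)).const_mul z).cexp
    simpa using this
  have hint : HasDerivAt (fun t : ℝ => ∫ u in (0 : ℝ)..t,
      Complex.exp (-(z * u)) • T.op u.toNNReal x) x 0 := by
    have := (T.continuous_exp_smul_op z x).integral_hasStrictDerivAt 0 0
    simpa [T.op_zero] using this.hasDerivAt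
  -- For `t ≥ 0` this function is `T_t y`, by `intervalIntegral_exp_smul_op` solved for `T_t y`;
  -- unlike the orbit it is defined for all real `t`.
  have hd : HasDerivAt (fun t : ℝ => Complex.exp (z * t) • y - Complex.exp (z * t) •
      ∫ u in (0 : ℝ)..t, Complex.exp (-(z * u)) • T.op u.toNNReal x) (z • y - x) 0 := by
    have := (hexp.smul_const y).sub (hexp.smul hint)
    simp only [Complex.ofReal_zero, mul_zero, Complex.exp_zero, one_smul,
      intervalIntegral.integral_same, smul_zero, add_zero] at this
    exact this
  have hs := hd.tendsto_slope
  have hcoe : Tendsto (fun t : ℝ≥0 => (t : ℝ)) (𝓝[>] 0) (𝓝[≠] 0) := by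
    refine tendsto_nhdsWithin_iff.2 ⟨?_, ?_⟩
    · exact (NNReal.continuous_coe.tendsto' 0 0 rfl).mono_left nhdsWithin_le_nhds
    · filter_upwards [self_mem_nhdsWithin] with t ht
      exact ne_of_gt (NNReal.coe_pos.2 ht)
  refine (hs.comp hcoe).congr fun t => ?_
  simp only [Function.comp, slope_def_module]
  rw [intervalIntegral_exp_smul_op hM hz t x, smul_sub (Complex.exp (z * _)), smul_smul,
    ← Complex.exp_add]
  simp only [Complex.ofReal_zero, mul_zero, Complex.exp_zero, intervalIntegral.integral_same,
    smul_zero, sub_zero, one_smul, add_neg_cancel, ← hy]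
  rw [← Complex.coe_smul]
  push_cast
  congr 1
  abel

theorem generator_apply {x y : X} (h : T.HasGeneratorAt x y) (hx : x ∈ T.generator.domain) :
    T.generator ⟨x, hx⟩ = y :=
  HasGeneratorAt.unique (Exists.choose_spec hx) h

/-- The Laplace transform commutes with `T_t` and is continuous, so it passes through the difference
quotients. This computes the generator at `laplace x` in a second way, and limits are unique. -/
theorem laplace_of_hasGeneratorAt [CompleteSpace X] {x y : X} (h : T.HasGeneratorAt x y) :
    laplace hM hz (z • x - y) = x := by
  have h1 : T.HasGeneratorAt (laplace hM hz x) (laplace hM hz y) := by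
    have := ((laplace hM hz).continuous.tendsto _).comp h
    refine this.congr fun t => ?_
    simp only [Function.comp, map_smul, map_sub, op_laplace]
  have := (hasGeneratorAt_laplace hM hz x).unique h1
  rw [map_sub, map_smul, ← this]
  abel

theorem isResolventAt_laplace [CompleteSpace X] :
    UnboundedOperator.IsResolventAt T.generator z (laplace hM hz) := by
  refine ⟨fun x => ⟨⟨_, hasGeneratorAt_laplace hM hz x⟩, ?_⟩, fun x => ?_⟩
  · refine (congrArg (z • laplace hM hz x - ·)
      (generator_apply (hasGeneratorAt_laplace hM hz x) _)).trans ?_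
    abel
  · exact laplace_of_hasGeneratorAt hM hz (Exists.choose_spec x.2)

include hM hz in
-- Every `y` is the limit of the averages `t⁻¹ ∫_0^t e^{-zu} T_u y du`, and these lie in the range.
theorem denseRange_laplace [CompleteSpace X] : DenseRange (laplace hM hz) := by
  intro y
  have hint : HasDerivAt (fun t : ℝ => ∫ u in (0 : ℝ)..t,
      Complex.exp (-(z * u)) • T.op u.toNNReal y) y 0 := by
    have := (T.continuous_exp_smul_op z y).integral_hasStrictDerivAt 0 0
    simpa [T.op_zero] using this.hasDerivAt
  have hs := hint.tendsto_slope.mono_left (nhdsWithin_mono (0 : ℝ)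
    (fun t (ht : t ∈ Set.Ioi (0 : ℝ)) => ne_of_gt ht))
  refine mem_closure_of_tendsto hs ?_
  filter_upwards [self_mem_nhdsWithin] with t ht
  have h1 := intervalIntegral_exp_smul_op hM hz t.toNNReal y
  rw [Real.coe_toNNReal t (le_of_lt ht), op_laplace hM hz] at h1
  simp only [slope_def_module, intervalIntegral.integral_same, sub_zero]
  refine ⟨((t⁻¹ : ℝ) : ℂ) • (y - Complex.exp (-(z * t)) • T.op t.toNNReal y), ?_⟩
  rw [map_smul, map_sub, map_smul, Complex.coe_smul]
  exact congrArg _ h1.symm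

end Laplace

end C0Semigroup

/-! ### Resolvent identity and holomorphy of the resolvent. -/

namespace UnboundedOperator

variable {X : Type*} [NormedAddCommGroup X] [NormedSpace ℂ X] {A : X →ₗ.[ℂ] X}

theorem IsResolventAt.sub_apply {z w : ℂ} {R S : X →L[ℂ] X} (hR : IsResolventAt A z R)
    (hS : IsResolventAt A w S) (x : X) : R x - S x = (w - z) • R (S x) := by
  obtain ⟨h, hx⟩ := hS.1 x
  have h1 := hR.2 ⟨S x, h⟩
  have h2 := congrArg R hx
  simp only [map_sub, map_smul] at h1 h2
  rw [sub_smul, ← h2, eq_sub_iff_add_eq, ← sub_eq_zero]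
  rw [← sub_eq_zero] at h1
  rw [← h1]
  abel

theorem IsResolventAt.unique {z : ℂ} {R S : X →L[ℂ] X} (hR : IsResolventAt A z R)
    (hS : IsResolventAt A z S) : R = S := by
  ext x
  have := hR.sub_apply hS x
  rwa [sub_self, zero_smul, sub_eq_zero] at this

theorem isResolventAt_resolvent {z : ℂ} (hz : z ∈ resolventSet A) :
    IsResolventAt A z (resolvent A z) := by
  have h : ∃ R : X →L[ℂ] X, IsResolventAt A z R := hz
  rw [resolvent, dif_pos h]
  exact h.choose_spec

theorem IsResolventAt.resolvent_eq {z : ℂ} {R : X →L[ℂ] X} (hR : IsResolventAt A z R) :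
    resolvent A z = R :=
  (isResolventAt_resolvent ⟨R, hR⟩).unique hR

theorem resolvent_sub_apply {z w : ℂ} (hz : z ∈ resolventSet A) (hw : w ∈ resolventSet A)
    (x : X) : resolvent A z x - resolvent A w x = (w - z) • resolvent A z (resolvent A w x) :=
  (isResolventAt_resolvent hz).sub_apply (isResolventAt_resolvent hw) x

theorem resolvent_comm {z w : ℂ} (hz : z ∈ resolventSet A) (hw : w ∈ resolventSet A) (x : X) :
    resolvent A z (resolvent A w x) = resolvent A w (resolvent A z x) := by
  rcases eq_or_ne z w with rfl | h
  · rfl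
  · have h1 := resolvent_sub_apply hz hw x
    have h2 := resolvent_sub_apply hw hz x
    refine smul_right_injective X (sub_ne_zero.2 h.symm) ?_
    simp only
    rw [← h1, ← neg_sub, h2, ← neg_smul, neg_sub]

/-- A resolvent that is locally bounded on an open subset of the resolvent set is strongly
differentiable there. -/
theorem differentiableOn_resolvent_apply {U : Set ℂ} (hU : IsOpen U) (hρ : U ⊆ resolventSet A)
    (hb : ∀ z ∈ U, ∃ C : ℝ, ∀ᶠ u in 𝓝 z, ‖resolvent A u‖ ≤ C) (x : X) :
    DifferentiableOn ℂ (fun z => resolvent A z x) U := by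
  have hcont : ∀ z ∈ U, ∀ y, ContinuousAt (fun z => resolvent A z y) z := by
    intro z hz y
    obtain ⟨C, hC⟩ := hb z hz
    rw [ContinuousAt, tendsto_iff_norm_sub_tendsto_zero]
    have h0 : Tendsto (fun u : ℂ => ‖z - u‖ * (C * ‖resolvent A z y‖)) (𝓝 z) (𝓝 0) := by
      have : Continuous fun u : ℂ => ‖z - u‖ * (C * ‖resolvent A z y‖) := by fun_prop
      exact this.tendsto' _ _ (by simp)
    refine squeeze_zero' (.of_forall fun _ => norm_nonneg _) ?_ h0
    filter_upwards [hC, hU.mem_nhds hz] with u hu huU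
    rw [resolvent_sub_apply (hρ huU) (hρ hz), norm_smul]
    gcongr
    exact (resolvent A u).le_of_opNorm_le hu _
  intro z hz
  -- The resolvent identity turns the difference quotient at `z` into `-R(u)R(z)x`, so strong
  -- continuity is enough.
  have hd : HasDerivAt (fun z => resolvent A z x) (-resolvent A z (resolvent A z x)) z := by
    rw [hasDerivAt_iff_tendsto_slope]
    have := ((hcont z hz (resolvent A z x)).tendsto).neg.mono_left
      (nhdsWithin_le_nhds (s := {z}ᶜ))
    refine this.congr' ?_
    filter_upwards [self_mem_nhdsWithin, mem_nhdsWithin_of_mem_nhds (hU.mem_nhds hz)] with u hu huU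
    rw [slope_def_module, resolvent_sub_apply (hρ huU) (hρ hz), smul_smul, ← neg_sub u z,
      mul_neg, inv_mul_cancel₀ (sub_ne_zero.2 hu), neg_one_smul]
  exact hd.differentiableAt.differentiableWithinAt

end UnboundedOperator

/-! ### The Fejér kernel and Fejér's theorem for vector-valued functions. -/

/-- The Fejér kernel on the real line. -/
def fejerKernel (v : ℝ) : ℝ := (1 - Real.cos v) / (Real.pi * v ^ 2)

theorem fejerKernel_nonneg (v : ℝ) : 0 ≤ fejerKernel v :=
  div_nonneg (by linarith [Real.cos_le_one v]) (by positivity)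

theorem fejerKernel_neg (v : ℝ) : fejerKernel (-v) = fejerKernel v := by
  simp [fejerKernel]

/-- Division by zero gives the kernel the value `0` at the origin, not its limit `1/(2π)`, so it is
only measurable; a single point does not affect the integrals. -/
theorem measurable_fejerKernel : Measurable fejerKernel := by
  unfold fejerKernel
  fun_prop

theorem fejerKernel_le_one (v : ℝ) : fejerKernel v ≤ 1 := by
  refine div_le_one_of_le₀ ?_ (by positivity)
  nlinarith [Real.one_sub_sq_div_two_le_cos (x := v), Real.pi_gt_three, sq_nonneg v]

theorem integral_exp_neg_mul_one_sub_cos {u : ℝ} (hu : 0 < u) :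
    IntegrableOn (fun v : ℝ => Real.exp (-(u * v)) * (1 - Real.cos v)) (Set.Ioi 0) ∧
      ∫ v in Set.Ioi (0 : ℝ), Real.exp (-(u * v)) * (1 - Real.cos v) = 1 / (u * (1 + u ^ 2)) := by
  have ha : ((-u : ℂ) + Complex.I).re < 0 := by simpa using hu
  have hb : ((-u : ℂ)).re < 0 := by simpa using hu
  have h1 := integrableOn_exp_mul_complex_Ioi ha 0
  have h2 := integrableOn_exp_mul_complex_Ioi hb 0
  have h3 : ∀ v : ℝ, Real.exp (-(u * v)) * (1 - Real.cos v) =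
      (Complex.exp (-u * v) - Complex.exp ((-u + Complex.I) * v)).re := by
    intro v
    simp [Complex.exp_re]
    ring
  have h4 := (h2.sub h1)
  simp only [h3]
  refine ⟨h4.re, ?_⟩
  have h5 := integral_re h4
  simp only [Pi.sub_apply, RCLike.re_to_complex] at h5
  rw [h5, integral_sub h2 h1, integral_exp_mul_complex_Ioi ha, integral_exp_mul_complex_Ioi hb]
  simp only [Complex.ofReal_zero, mul_zero, Complex.exp_zero, Complex.sub_re, Complex.div_re,
    Complex.neg_re, Complex.one_re, Complex.ofReal_re, Complex.normSq_apply, Complex.neg_im,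
    Complex.one_im, Complex.ofReal_im, Complex.add_re, Complex.add_im, Complex.I_re, Complex.I_im]
  have : u ≠ 0 := hu.ne'
  have : u * u + 1 ≠ 0 := by positivity
  field_simp
  ring

/-- Write `1/v² = ∫_0^∞ u e^{-uv} du` and exchange the integrals by Tonelli: the `v`-integral leaves
`1/(1+u²)`, whose integral over the half line is `π/2`. -/
theorem lintegral_one_sub_cos_div_sq :
    ∫⁻ v in Set.Ioi (0 : ℝ), ENNReal.ofReal ((1 - Real.cos v) / v ^ 2) =
      ENNReal.ofReal (Real.pi / 2) := by
  have h1 : ∀ v ∈ Set.Ioi (0 : ℝ), ENNReal.ofReal ((1 - Real.cos v) / v ^ 2) =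
      ∫⁻ u in Set.Ioi (0 : ℝ), ENNReal.ofReal (u * Real.exp (-(u * v)) * (1 - Real.cos v)) := by
    intro v hv
    have hv' : (0 : ℝ) < v := hv
    have hi := Real.integral_rpow_mul_exp_neg_mul_Ioi (a := 2) (by norm_num) hv'
    norm_num at hi
    have hval : ∫ u in Set.Ioi (0 : ℝ), u * Real.exp (-(u * v)) * (1 - Real.cos v) =
        (1 - Real.cos v) / v ^ 2 := by
      rw [integral_mul_const]
      simp only [mul_comm _ v]
      rw [hi]
      ring
    have hint : IntegrableOn (fun u => u * Real.exp (-(u * v)) * (1 - Real.cos v))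
        (Set.Ioi (0 : ℝ)) := by
      refine Integrable.mul_const ?_ _
      simp only [mul_comm _ v]
      -- A Bochner integral with nonzero value forces integrability.
      refine not_imp_comm.1 integral_undef ?_
      rw [hi]
      positivity
    rw [← hval, ofReal_integral_eq_lintegral_ofReal hint]
    refine (ae_restrict_mem measurableSet_Ioi).mono fun u hu => ?_
    have hu' : (0 : ℝ) < u := hu
    have := Real.cos_le_one v
    exact mul_nonneg (by positivity) (by linarith)
  have h2 : ∀ u ∈ Set.Ioi (0 : ℝ),
      ∫⁻ v in Set.Ioi (0 : ℝ), ENNReal.ofReal (u * Real.exp (-(u * v)) * (1 - Real.cos v)) =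
        ENNReal.ofReal ((1 + u ^ 2)⁻¹) := by
    intro u hu
    have hu' : (0 : ℝ) < u := hu
    obtain ⟨hi, hv⟩ := integral_exp_neg_mul_one_sub_cos hu'
    simp only [mul_assoc]
    rw [← ofReal_integral_eq_lintegral_ofReal (hi.const_mul u), integral_const_mul, hv]
    · congr 1
      field_simp
    · refine .of_forall fun v => ?_
      have := Real.cos_le_one v
      exact mul_nonneg hu'.le (mul_nonneg (Real.exp_pos _).le (by linarith))
  rw [setLIntegral_congr_fun measurableSet_Ioi h1, lintegral_lintegral_swap (by fun_prop),
    setLIntegral_congr_fun measurableSet_Ioi h2, ← ofReal_integral_eq_lintegral_ofReal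
      integrable_inv_one_add_sq.integrableOn (.of_forall fun u => by positivity),
    integral_Ioi_inv_one_add_sq]
  simp

theorem integral_fejerKernel : ∫ v, fejerKernel v = 1 := by
  have h1 : ∫ v in Set.Ioi (0 : ℝ), fejerKernel v = 1 / 2 := by
    have h2 : ∫ v in Set.Ioi (0 : ℝ), (1 - Real.cos v) / v ^ 2 = Real.pi / 2 := by
      rw [integral_eq_lintegral_of_nonneg_ae, lintegral_one_sub_cos_div_sq,
        ENNReal.toReal_ofReal (by positivity)]
      · exact .of_forall fun v => div_nonneg (by linarith [Real.cos_le_one v]) (by positivity)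
      · exact Measurable.aestronglyMeasurable (by fun_prop)
    have h3 : ∀ v, fejerKernel v = Real.pi⁻¹ * ((1 - Real.cos v) / v ^ 2) := by
      intro v
      rw [fejerKernel]
      field_simp
    simp only [h3]
    rw [integral_const_mul, h2]
    field_simp
  have h2 := integral_comp_abs (f := fejerKernel)
  have h3 : ∀ v, fejerKernel |v| = fejerKernel v := by simp [fejerKernel]
  simp only [h3] at h2
  rw [h2, h1]
  norm_num

theorem tendsto_norm_mul_fejerKernel :
    Tendsto (fun v : ℝ => ‖v‖ * fejerKernel v) (Bornology.cobounded ℝ) (𝓝 0) := by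
  have h1 : Tendsto (fun v : ℝ => 2 / Real.pi * ‖v‖⁻¹) (Bornology.cobounded ℝ) (𝓝 0) := by
    simpa using (tendsto_inv_atTop_zero.comp (tendsto_norm_cobounded_atTop (E := ℝ))).const_mul (2 / Real.pi)
  refine squeeze_zero (fun v => mul_nonneg (norm_nonneg v) (fejerKernel_nonneg v)) (fun v => ?_) h1
  rcases eq_or_ne v 0 with rfl | hv
  · simp
  have hv' : 0 < ‖v‖ := norm_pos_iff.2 hv
  rw [fejerKernel, ← sq_abs, ← Real.norm_eq_abs]
  have : ‖v‖ * ((1 - Real.cos v) / (Real.pi * ‖v‖ ^ 2)) =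
      (1 - Real.cos v) / Real.pi * ‖v‖⁻¹ := by field_simp
  rw [this]
  gcongr
  linarith [Real.neg_one_le_cos v]

section Fejer

variable {X : Type*} [NormedAddCommGroup X] [NormedSpace ℂ X]

/-- Fubini for a bounded kernel, needed once for the frequency `s` and once for the cutoff `l`. -/
theorem intervalIntegral_integral_smul_comm {f : ℝ → X} (hf : Integrable f) {k : ℝ → ℝ → ℂ}
    (hk : Continuous (Function.uncurry k)) {a b C : ℝ} (hab : a ≤ b)
    (hC : ∀ s ∈ Set.Ioc a b, ∀ u, ‖k s u‖ ≤ C) [CompleteSpace X] :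
    ∫ s in a..b, ∫ u, k s u • f u = ∫ u, (∫ s in a..b, k s u) • f u := by
  have hint : Integrable (Function.uncurry fun s u => k s u • f u)
      ((volume.restrict (Set.Ioc a b)).prod volume) := by
    have h1 : Integrable (fun p : ℝ × ℝ => f p.2) ((volume.restrict (Set.Ioc a b)).prod volume) :=
      hf.comp_snd _
    have h2 : ∀ᵐ p : ℝ × ℝ ∂((volume.restrict (Set.Ioc a b)).prod volume),
        ‖Function.uncurry k p‖ ≤ C := by
      have : ∀ᵐ p : ℝ × ℝ ∂((volume.restrict (Set.Ioc a b)).prod volume), p.1 ∈ Set.Ioc a b :=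
        Measure.quasiMeasurePreserving_fst.ae (ae_restrict_mem measurableSet_Ioc)
      exact this.mono fun p hp => hC _ hp _
    exact h1.bdd_smul C hk.aestronglyMeasurable h2
  rw [intervalIntegral.integral_of_le hab, integral_integral_swap hint]
  refine integral_congr_ae (.of_forall fun u => ?_)
  simp only
  rw [integral_smul_const, intervalIntegral.integral_of_le hab]

/-- The Dirichlet kernel, written with `Real.sinc` so that it is jointly continuous in `l` and `v`,
as the second use of Fubini requires. -/
theorem intervalIntegral_exp_mul_I (l v : ℝ) :
    ∫ s in (-l)..l, Complex.exp (s * v * Complex.I) = ((2 * (l * Real.sinc (l * v)) : ℝ) : ℂ) := by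
  rcases eq_or_ne v 0 with rfl | hv
  · simp
    ring
  rcases eq_or_ne l 0 with rfl | hl
  · simp
  have h0 : (v * Complex.I : ℂ) ≠ 0 := by simp [hv]
  have h1 : ∀ s : ℝ, Complex.exp (s * v * Complex.I) = Complex.exp ((v * Complex.I) * s) :=
    fun s => by ring_nf
  simp only [h1]
  rw [integral_exp_mul_complex h0, Real.sinc_of_ne_zero (mul_ne_zero hl hv)]
  have hv' : (v : ℂ) ≠ 0 := by exact_mod_cast hv
  have hl' : (l : ℂ) ≠ 0 := by exact_mod_cast hl
  have h2 := Complex.two_sin ((l * v : ℝ) : ℂ)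
  push_cast at h2 ⊢
  have e1 : (v * Complex.I * l : ℂ) = l * v * Complex.I := by ring
  have e2 : (v * Complex.I * -l : ℂ) = -(l * v * Complex.I) := by ring
  rw [neg_mul] at h2
  rw [e1, e2]
  field_simp
  linear_combination (-Complex.I) * h2 +
    (Complex.exp (l * v * Complex.I) - Complex.exp (-(l * v * Complex.I))) * Complex.I_sq

theorem intervalIntegral_mul_sinc (N : ℝ) {v : ℝ} (hv : v ≠ 0) (hN : N ≠ 0) :
    ∫ l in (0 : ℝ)..N, 2 * (l * Real.sinc (l * v)) =
      N * (2 * Real.pi * (N * fejerKernel (N * v))) := by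
  have h1 : ∀ l : ℝ, HasDerivAt (fun l => -2 * Real.cos (l * v) / v ^ 2)
      (2 * (l * Real.sinc (l * v))) l := by
    intro l
    have := ((((hasDerivAt_id l).mul_const v).cos).const_mul (-2)).div_const (v ^ 2)
    refine this.congr_deriv ?_
    simp only [id]
    rcases eq_or_ne l 0 with rfl | hl
    · simp
    rw [Real.sinc_of_ne_zero (mul_ne_zero hl hv)]
    field_simp
  rw [intervalIntegral.integral_eq_sub_of_hasDerivAt (fun l _ => h1 l)]
  · rw [fejerKernel]
    have := Real.pi_ne_zero
    field_simp
    simp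
    ring
  · have := Real.continuous_sinc
    exact Continuous.intervalIntegrable (by fun_prop) _ _

/-- Fejér's theorem on the real line. -/
theorem tendsto_cesaro_fourier [CompleteSpace X] {f : ℝ → X} (hf : Integrable f) (t : ℝ) {y : X}
    (hy : Tendsto (fun v => f (t + v) + f (t - v)) (𝓝[≠] 0) (𝓝 y)) :
    Tendsto (fun N : ℝ => N⁻¹ • ∫ l in (0 : ℝ)..N, ∫ s in (-l)..l,
      Complex.exp (s * t * Complex.I) • ∫ u : ℝ, Complex.exp (-(s * u * Complex.I)) • f u)
      atTop (𝓝 ((Real.pi : ℝ) • y)) := by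
  have hsinc := Real.continuous_sinc
  have hinner : ∀ l : ℝ, 0 ≤ l → ∫ s in (-l)..l, Complex.exp (s * t * Complex.I) •
      ∫ u : ℝ, Complex.exp (-(s * u * Complex.I)) • f u =
        ∫ u, ((2 * (l * Real.sinc (l * (t - u))) : ℝ) : ℂ) • f u := by
    intro l hl
    simp only [← intervalIntegral_exp_mul_I]
    rw [← intervalIntegral_integral_smul_comm hf (C := 1) (by fun_prop) (by linarith)]
    · congr 1 with s
      rw [← integral_smul]
      congr 1 with u
      rw [smul_smul, ← Complex.exp_add]
      congr 2
      push_cast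
      ring
    · intro s _ u
      rw [← Complex.ofReal_mul, Complex.norm_exp_ofReal_mul_I]
  have hmean : ∀ N : ℝ, 0 < N → N⁻¹ • ∫ l in (0 : ℝ)..N, ∫ s in (-l)..l,
      Complex.exp (s * t * Complex.I) • ∫ u : ℝ, Complex.exp (-(s * u * Complex.I)) • f u =
        (2 * Real.pi) • ∫ u, (N * fejerKernel (N * (t - u))) • f u := by
    intro N hN
    have h1 : ∫ l in (0 : ℝ)..N, ∫ s in (-l)..l,
        Complex.exp (s * t * Complex.I) • ∫ u : ℝ, Complex.exp (-(s * u * Complex.I)) • f u =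
        ∫ l in (0 : ℝ)..N, ∫ u, ((2 * (l * Real.sinc (l * (t - u))) : ℝ) : ℂ) • f u := by
      refine intervalIntegral.integral_congr fun l hl => hinner l ?_
      rw [Set.uIcc_of_le hN.le] at hl
      exact hl.1
    rw [h1, intervalIntegral_integral_smul_comm hf (C := 2 * N) (by fun_prop) hN.le,
      ← integral_smul, ← integral_smul]
    · refine integral_congr_ae ?_
      have : ∀ᵐ u : ℝ, u ≠ t := by simp [ae_iff, measure_singleton]
      filter_upwards [this] with u hu
      rw [intervalIntegral.integral_ofReal, intervalIntegral_mul_sinc N (sub_ne_zero.2 hu.symm) hN.ne',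
        Complex.coe_smul, smul_smul, smul_smul]
      congr 1
      field_simp
    · intro l hl u
      rw [Complex.norm_real, norm_mul, norm_mul, Real.norm_two, Real.norm_of_nonneg hl.1.le,
        Real.norm_eq_abs]
      have := Real.abs_sinc_le_one (l * (t - u))
      have h2 := abs_nonneg (Real.sinc (l * (t - u)))
      nlinarith [hl.1, hl.2]
  -- The kernel is even, so integrating it against `f` gives half its integral against the
  -- symmetrization `g`. Setting `g 0 = y` makes `g` continuous at `0`, and the limit is `2π · y/2`.
  set g : ℝ → X := Function.update (fun v => f (t + v) + f (t - v)) 0 y with hg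
  have hfp : Integrable fun v => f (t + v) := hf.comp_add_left t
  have hfm : Integrable fun v => f (t - v) := hf.comp_sub_left t
  have hgae : (fun v => f (t + v) + f (t - v)) =ᵐ[volume] g := by
    have : ∀ᵐ u : ℝ, u ≠ 0 := by simp [ae_iff, measure_singleton]
    filter_upwards [this] with u hu
    rw [hg, Function.update_of_ne hu]
  have hgi : Integrable g := (hfp.add hfm).congr hgae
  have hgc : ContinuousAt g 0 := continuousAt_update_same.2 hy
  have key := tendsto_integral_comp_smul_smul_of_integrable fejerKernel_nonneg
    integral_fejerKernel (by simpa using tendsto_norm_mul_fejerKernel) hgi hgc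
  have hg0 : g 0 = y := Function.update_self ..
  rw [hg0] at key
  simp only [Module.finrank_self, pow_one, smul_eq_mul] at key
  refine (key.const_smul Real.pi).congr' ?_
  filter_upwards [eventually_gt_atTop 0] with N hN
  rw [hmean N hN]
  have hK : ∀ {F : ℝ → X}, Integrable F →
      Integrable fun v => (N * fejerKernel (N * v)) • F v := by
    intro F hF
    refine hF.bdd_smul (𝕜 := ℝ) N ?_ (.of_forall fun v => ?_)
    · exact ((measurable_fejerKernel.comp (measurable_const_mul N)).const_mul N).aestronglyMeasurable
    · rw [Real.norm_of_nonneg (mul_nonneg hN.le (fejerKernel_nonneg _))]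
      nlinarith [fejerKernel_le_one (N * v)]
  have e1 : ∫ v, (N * fejerKernel (N * v)) • f (t - v) =
      ∫ u, (N * fejerKernel (N * (t - u))) • f u := by
    rw [← integral_sub_left_eq_self _ volume t]
    simp
  have e2 : ∫ v, (N * fejerKernel (N * v)) • f (t + v) =
      ∫ u, (N * fejerKernel (N * (t - u))) • f u := by
    rw [← integral_add_left_eq_self (fun u => (N * fejerKernel (N * (t - u))) • f u) t]
    congr 1 with v
    rw [← fejerKernel_neg]
    congr 3
    ring
  have e3 : ∫ v, (N * fejerKernel (N * v)) • g v =
      ∫ v, ((N * fejerKernel (N * v)) • f (t + v) + (N * fejerKernel (N * v)) • f (t - v)) := by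
    refine integral_congr_ae (hgae.mono fun v hv => ?_)
    simp only [← hv, smul_add]
  rw [e3, integral_add (hK hfp) (hK hfm), e1, e2, ← two_smul ℝ, smul_smul, mul_comm]

/-! ### Complex inversion to the right of the growth bound. -/

namespace C0Semigroup

theorem tendsto_cesaro_resolvent [CompleteSpace X] {T : C0Semigroup X} {M w : ℝ}
    (hM : ∀ t : ℝ≥0, ‖T.op t‖ ≤ M * Real.exp (w * t)) {h : ℝ} (hh : w < h) (t : ℝ) (x : X) :
    Tendsto (fun N : ℝ => N⁻¹ • ∫ l in (0 : ℝ)..N, ∫ s in (-l)..l, Complex.I •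
      (Complex.exp ((h + s * Complex.I) * t) •
        UnboundedOperator.resolvent T.generator (h + s * Complex.I) x)) atTop
      (𝓝 ((2 * Real.pi * Complex.I) • T.extendedOrbit t x)) := by
  set f : ℝ → X := (Set.Ioi 0).indicator fun u => Complex.exp (-(h * u)) • T.op u.toNNReal x
    with hf_def
  have hcont := T.continuous_exp_smul_op h x
  have hfi : Integrable f := (integrable_indicator_iff measurableSet_Ioi).2
    (integrableOn_exp_smul_op hM (z := h) (by simpa using hh) x)
  have hlim : Tendsto (fun v => f (t + v) + f (t - v)) (𝓝[≠] 0)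
      (𝓝 ((2 * Complex.exp (-(h * t))) • T.extendedOrbit t x)) := by
    rcases lt_trichotomy t 0 with ht | rfl | ht
    · rw [extendedOrbit, if_neg ht.not_gt, if_neg ht.ne, smul_zero]
      refine tendsto_const_nhds.congr' ?_
      have : ∀ᶠ v : ℝ in 𝓝[≠] 0, |v| < -t :=
        mem_nhdsWithin_of_mem_nhds (by
          filter_upwards [Metric.ball_mem_nhds (0 : ℝ) (neg_pos.2 ht)] with v hv
          simpa using hv)
      filter_upwards [this] with v hv
      have := abs_lt.1 hv
      rw [hf_def, Set.indicator_of_notMem, Set.indicator_of_notMem, add_zero]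
      · simp only [Set.mem_Ioi]; linarith
      · simp only [Set.mem_Ioi]; linarith
    -- At the jump exactly one of `f v`, `f (-v)` is nonzero, so the symmetric sum is the damped
    -- orbit at `|v|`. It tends to `x`, which is twice `x/2`.
    · have h1 : (2 * Complex.exp (-(h * (0 : ℝ)))) • T.extendedOrbit 0 x = x := by
        simp [extendedOrbit, smul_smul]
      rw [h1]
      have h2 : Tendsto (fun v : ℝ => Complex.exp (-(h * (|v| : ℝ))) • T.op (|v|).toNNReal x)
          (𝓝[≠] 0) (𝓝 x) := by
        refine ((hcont.comp continuous_abs).tendsto' 0 x ?_).mono_left nhdsWithin_le_nhds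
        simp [T.op_zero]
      refine h2.congr' ?_
      filter_upwards [self_mem_nhdsWithin] with v hv
      rcases lt_or_gt_of_ne hv with hv | hv
      · rw [hf_def, Set.indicator_of_notMem (by simpa using hv.le),
          Set.indicator_of_mem (by simpa using hv), abs_of_neg hv]
        simp
      · rw [hf_def, Set.indicator_of_mem (by simpa using hv),
          Set.indicator_of_notMem (by simpa using le_of_lt hv), abs_of_pos hv]
        simp
    · have hft : ContinuousAt f t := by
        refine hcont.continuousAt.congr ?_
        filter_upwards [Ioi_mem_nhds ht] with u hu
        rw [hf_def, Set.indicator_of_mem hu]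
      have hval : f t = Complex.exp (-(h * t)) • T.extendedOrbit t x := by
        rw [hf_def, Set.indicator_of_mem (by exact ht), extendedOrbit, if_pos ht]
      rw [mul_smul, ← hval, two_smul]
      refine Tendsto.mono_left (Tendsto.add ?_ ?_) nhdsWithin_le_nhds
      · exact hft.tendsto.comp ((continuous_const.add continuous_id).tendsto' 0 t (by simp))
      · exact hft.tendsto.comp ((continuous_const.sub continuous_id).tendsto' 0 t (by simp))
  -- The factor `e^{ht}` undoes the damping and `I` comes from `dz = i ds`.
  have key := (tendsto_cesaro_fourier hfi t hlim).const_smul (Complex.I * Complex.exp (h * t))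
  have e : (Complex.I * Complex.exp (h * t)) • ((Real.pi : ℝ) •
      ((2 * Complex.exp (-(h * t))) • T.extendedOrbit t x)) =
      (2 * Real.pi * Complex.I) • T.extendedOrbit t x := by
    rw [← Complex.coe_smul, smul_smul, smul_smul]
    congr 1
    have : Complex.exp (h * t) * Complex.exp (-(h * t)) = 1 := by
      rw [← Complex.exp_add]; simp
    linear_combination (2 * Real.pi * Complex.I) * this
  rw [e] at key
  refine key.congr fun N => ?_
  rw [smul_comm, ← intervalIntegral.integral_smul]
  congr 2 with l
  rw [← intervalIntegral.integral_smul]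
  congr 1 with s
  have hre : w < ((h : ℂ) + s * Complex.I).re := by simpa using hh
  rw [(isResolventAt_laplace hM hre).resolvent_eq, laplace_apply]
  have h3 : ∫ u : ℝ, Complex.exp (-(s * u * Complex.I)) • f u =
      ∫ u in Set.Ioi (0 : ℝ), Complex.exp (-((h + s * Complex.I) * u)) • T.op u.toNNReal x := by
    rw [← integral_indicator measurableSet_Ioi]
    congr 1 with u
    by_cases hu : u ∈ Set.Ioi (0 : ℝ)
    · rw [hf_def, Set.indicator_of_mem hu, Set.indicator_of_mem hu, smul_smul, ← Complex.exp_add]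
      congr 2
      ring
    · rw [hf_def, Set.indicator_of_notMem hu, Set.indicator_of_notMem hu, smul_zero]
  rw [h3, smul_smul, smul_smul, mul_assoc, ← Complex.exp_add]
  congr 3
  ring

end C0Semigroup

end Fejer

/-! ### Geometry of the rays and the scalar Cauchy integral of `μ^{-α}`. -/

namespace UnboundedOperator

/-- The point at parameter `r` of the ray from `-c` in the direction `e^{iφ}`. -/
def rayPoint (c φ r : ℝ) : ℂ := -c + r * Complex.exp (φ * Complex.I)

theorem rayPoint_re (c φ r : ℝ) : (rayPoint c φ r).re = -c + r * Real.cos φ := by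
  simp [rayPoint, Complex.exp_ofReal_mul_I_re]

theorem rayPoint_im (c φ r : ℝ) : (rayPoint c φ r).im = r * Real.sin φ := by
  simp [rayPoint, Complex.exp_ofReal_mul_I_im]

theorem continuous_rayPoint (c φ : ℝ) : Continuous (rayPoint c φ) := by
  unfold rayPoint
  fun_prop

theorem neg_rayPoint_mem_slitPlane {c φ r : ℝ} (hc : 0 < c) (hφ : Real.sin φ ≠ 0) (hr : 0 ≤ r) :
    -rayPoint c φ r ∈ Complex.slitPlane := by
  rw [Complex.mem_slitPlane_iff, Complex.neg_re, Complex.neg_im, rayPoint_re, rayPoint_im]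
  rcases hr.eq_or_lt with rfl | hr
  · left; simpa using hc
  · right; simpa using ⟨hr.ne', hφ⟩

/-- With `k² = (1 - cos φ)/2`, the law of cosines leaves `‖·‖² - k²(c+r)² = (1 + cos φ)(c-r)²/2 ≥
0`. -/
theorem exists_mul_le_norm_rayPoint {φ : ℝ} (hφ : Real.cos φ < 1) :
    ∃ k : ℝ, 0 < k ∧ ∀ c r : ℝ, 0 ≤ c → 0 ≤ r → k * (c + r) ≤ ‖rayPoint c φ r‖ := by
  refine ⟨Real.sqrt ((1 - Real.cos φ) / 2), Real.sqrt_pos.2 (by linarith), fun c r hc hr => ?_⟩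
  refine abs_le_of_sq_le_sq' ?_ (norm_nonneg _) |>.2
  rw [mul_pow, Real.sq_sqrt (by linarith), ← Complex.normSq_eq_norm_sq, Complex.normSq_apply,
    rayPoint_re, rayPoint_im]
  have h1 : (-c + r * Real.cos φ) * (-c + r * Real.cos φ) + r * Real.sin φ * (r * Real.sin φ) =
      c ^ 2 + r ^ 2 - 2 * (c * r) * Real.cos φ := by
    linear_combination r ^ 2 * Real.sin_sq_add_cos_sq φ
  rw [h1]
  have h2 := Real.neg_one_le_cos φ
  nlinarith [mul_nonneg (sq_nonneg (c - r)) (by linarith : 0 ≤ 1 + Real.cos φ), mul_nonneg hc hr]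

/-- The ray makes an angle below `π/4` with the real axis, while `z` lies in the vertical double
cone of half-angle `π/4` at the vertex `-c`. The component of `q` normal to the ray controls `|Im
z|`, and the triangle inequality then controls `r`. -/
theorem exists_mul_le_norm_rayPoint_sub {φ : ℝ} (hφ : |Real.sin φ| < Real.cos φ) :
    ∃ k : ℝ, 0 < k ∧ ∀ (z : ℂ) (c r : ℝ), |c + z.re| ≤ |z.im| → 0 ≤ r →
      k * (|z.im| + r) ≤ ‖rayPoint c φ r - z‖ := by
  set k₁ := Real.cos φ - |Real.sin φ| with hk
  have hk₁ : 0 < k₁ := by linarith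
  -- From `k₁|Im z| ≤ ‖q‖` and `r ≤ ‖q‖ + 2|Im z|` one gets `k₁(|Im z| + r) ≤ (k₁ + 3)‖q‖`.
  refine ⟨k₁ / (k₁ + 3), by positivity, fun z c r hc hr => ?_⟩
  set q := rayPoint c φ r - z with hq
  have hqre : q.re = r * Real.cos φ - (c + z.re) := by
    rw [hq, Complex.sub_re, rayPoint_re]; ring
  have hqim : q.im = r * Real.sin φ - z.im := by
    rw [hq, Complex.sub_im, rayPoint_im]
  have hn : ‖q‖ ^ 2 = q.re ^ 2 + q.im ^ 2 := by
    rw [← Complex.normSq_eq_norm_sq, Complex.normSq_apply]; ring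
  have hcs := Real.sin_sq_add_cos_sq φ
  have hpos : 0 < Real.cos φ := (abs_nonneg _).trans_lt hφ
  have h1 : k₁ * |z.im| ≤ ‖q‖ := by
    have e1 : |q.re * Real.sin φ - q.im * Real.cos φ| ≤ ‖q‖ := by
      refine abs_le_of_sq_le_sq ?_ (norm_nonneg _)
      rw [hn]
      nlinarith [sq_nonneg (q.re * Real.cos φ + q.im * Real.sin φ)]
    have e2 : q.re * Real.sin φ - q.im * Real.cos φ =
        z.im * Real.cos φ - (c + z.re) * Real.sin φ := by rw [hqre, hqim]; ring
    rw [e2] at e1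
    refine le_trans ?_ e1
    have e3 := abs_sub_abs_le_abs_sub (z.im * Real.cos φ) ((c + z.re) * Real.sin φ)
    rw [abs_mul, abs_mul, abs_of_pos hpos] at e3
    nlinarith [abs_nonneg (Real.sin φ)]
  have h2 : r ≤ ‖q‖ + 2 * |z.im| := by
    have e1 : (r : ℂ) * Complex.exp (φ * Complex.I) = q + (c + z) := by
      rw [hq, rayPoint]; ring
    have e2 : ‖(r : ℂ) * Complex.exp (φ * Complex.I)‖ = r := by
      rw [norm_mul, Complex.norm_exp_ofReal_mul_I, Complex.norm_real, Real.norm_of_nonneg hr,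
        mul_one]
    have e3 : ‖(c : ℂ) + z‖ ≤ 2 * |z.im| := by
      refine (Complex.norm_le_abs_re_add_abs_im _).trans ?_
      simp only [Complex.add_re, Complex.ofReal_re, Complex.add_im, Complex.ofReal_im, zero_add]
      linarith
    rw [← e2, e1]
    exact (norm_add_le _ _).trans (by linarith)
  rw [div_mul_eq_mul_div, div_le_iff₀ (by positivity)]
  nlinarith [norm_nonneg q]

theorem norm_negPow (α : ℝ) {μ : ℂ} (hμ : μ ≠ 0) : ‖negPow α μ‖ = ‖μ‖ ^ (-α) := by
  rw [negPow, Complex.norm_exp, Real.rpow_def_of_pos (norm_pos_iff.2 hμ)]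
  congr 1
  simp [Complex.log_re]
  ring

theorem hasDerivAt_negPow (α : ℝ) {μ : ℂ} (hμ : -μ ∈ Complex.slitPlane) :
    HasDerivAt (negPow α) (negPow α μ * (-α / μ)) μ := by
  have h0 : μ ≠ 0 := by
    rintro rfl
    simp at hμ
  have := (((hasDerivAt_neg μ).clog hμ).add_const (Real.pi * Complex.I)).const_mul (-α : ℂ) |>.cexp
  refine this.congr_deriv ?_
  rw [negPow]
  field_simp

/-- The integral of `f` along the ray from `-c` in the direction `e^{iφ}`. -/
def rayIntegral (f : ℂ → ℂ) (φ c : ℝ) : ℂ :=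
  ∫ r in Set.Ioi (0 : ℝ), Complex.exp (φ * Complex.I) * f (rayPoint c φ r)

theorem hasDerivAt_rayPoint_left (φ r c : ℝ) : HasDerivAt (fun c => rayPoint c φ r) (-1) c := by
  have := (Complex.ofRealCLM.hasDerivAt (x := c)).neg.add_const
    ((r : ℂ) * Complex.exp (φ * Complex.I))
  exact this.congr_deriv (by simp)

theorem hasDerivAt_rayPoint_right (c φ r : ℝ) :
    HasDerivAt (rayPoint c φ) (Complex.exp (φ * Complex.I)) r := by
  have := ((Complex.ofRealCLM.hasDerivAt (x := r)).mul_const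
    (Complex.exp (φ * Complex.I))).const_add (-c : ℂ)
  exact this.congr_deriv (by simp)

theorem integrableOn_mul_one_add_rpow {m b s : ℝ} (hb : 0 < b) (hm : 0 < m) (hs : s < -1) :
    IntegrableOn (fun r : ℝ => (m * (b + r)) ^ s) (Set.Ioi 0) := by
  have h1 := (integrableOn_add_rpow_Ioi_of_lt (m := b) (c := 0) hs (by linarith)).const_mul (m ^ s)
  refine IntegrableOn.congr_fun h1 (fun r hr => ?_) measurableSet_Ioi
  have hr' : (0 : ℝ) < r := hr
  rw [Real.mul_rpow hm.le (by positivity), add_comm]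

theorem integral_mul_add_rpow {m b s : ℝ} (hb : 0 < b) (hm : 0 < m) (hs : 0 < s) :
    ∫ r in Set.Ioi (0 : ℝ), (m * (b + r)) ^ (-s - 1) = m ^ (-s - 1) / s * b ^ (-s) := by
  have h1 : ∫ r in Set.Ioi (0 : ℝ), (m * (b + r)) ^ (-s - 1) =
      ∫ r in Set.Ioi (0 : ℝ), m ^ (-s - 1) * (r + b) ^ (-s - 1) := by
    refine setIntegral_congr_fun measurableSet_Ioi fun r hr => ?_
    have hr' : (0 : ℝ) < r := hr
    rw [Real.mul_rpow hm.le (by positivity), add_comm]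
  rw [h1, integral_const_mul, integral_Ioi_comp_add_right (fun r : ℝ => r ^ (-s - 1)), zero_add,
    integral_Ioi_rpow_of_lt (by linarith) hb]
  have : -s - 1 + 1 = -s := by ring
  rw [this]
  field_simp

section Cauchy

/-- The integrand `μ^{-α} / (μ - z)`. -/
def cauchyPow (α : ℝ) (z μ : ℂ) : ℂ := negPow α μ / (μ - z)

theorem norm_cauchyPow_le {α ρ : ℝ} (hα : 0 ≤ α) (hρ : 0 < ρ) {z μ : ℂ} (h1 : ρ ≤ ‖μ‖)
    (h2 : ρ ≤ ‖μ - z‖) : ‖cauchyPow α z μ‖ ≤ ρ ^ (-α - 1) := by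
  rw [cauchyPow, norm_div, norm_negPow α (norm_pos_iff.1 (hρ.trans_le h1)), Real.rpow_sub_one hρ.ne']
  exact div_le_div₀ (Real.rpow_nonneg hρ.le _)
    (Real.rpow_le_rpow_of_nonpos hρ h1 (by linarith)) hρ h2

theorem hasDerivAt_cauchyPow (α : ℝ) {z μ : ℂ} (h1 : -μ ∈ Complex.slitPlane) (h2 : μ - z ≠ 0) :
    HasDerivAt (cauchyPow α z)
      ((negPow α μ * (-α / μ) * (μ - z) - negPow α μ * 1) / (μ - z) ^ 2) μ :=
  (hasDerivAt_negPow α h1).div ((hasDerivAt_id μ).sub_const z) h2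

theorem norm_deriv_cauchyPow_le {α ρ : ℝ} (hα : 0 ≤ α) (hρ : 0 < ρ) {z μ : ℂ} (h1 : ρ ≤ ‖μ‖)
    (h2 : ρ ≤ ‖μ - z‖) : ‖(negPow α μ * (-α / μ) * (μ - z) - negPow α μ * 1) / (μ - z) ^ 2‖ ≤
      (α + 1) * ρ ^ (-α - 2) := by
  have hμ : μ ≠ 0 := norm_pos_iff.1 (hρ.trans_le h1)
  have hz : μ - z ≠ 0 := norm_pos_iff.1 (hρ.trans_le h2)
  have e : (negPow α μ * (-α / μ) * (μ - z) - negPow α μ * 1) / (μ - z) ^ 2 =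
      cauchyPow α z μ * (-α / μ - 1 / (μ - z)) := by
    rw [cauchyPow]
    field_simp
  rw [e, norm_mul]
  have h3 : ‖(-α / μ - 1 / (μ - z) : ℂ)‖ ≤ (α + 1) / ρ := by
    refine (norm_sub_le _ _).trans ?_
    rw [norm_div, norm_div, norm_neg, Complex.norm_real, Real.norm_of_nonneg hα, norm_one, add_div]
    gcongr
  calc _ ≤ ρ ^ (-α - 1) * ((α + 1) / ρ) :=
        mul_le_mul (norm_cauchyPow_le hα hρ h1 h2) h3 (norm_nonneg _) (Real.rpow_nonneg hρ.le _)
    _ = (α + 1) * (ρ ^ (-α - 1) / ρ) := by ring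
    _ = _ := by rw [← Real.rpow_sub_one hρ.ne']; ring_nf

variable {α φ : ℝ} {z : ℂ}

theorem continuousOn_cauchyPow_rayPoint {c m : ℝ} (hc : 0 < c) (hm : 0 < m)
    (hφ : Real.sin φ ≠ 0) (h2 : ∀ r, 0 ≤ r → m * (1 + r) ≤ ‖rayPoint c φ r - z‖) :
    ContinuousOn (fun r => cauchyPow α z (rayPoint c φ r)) (Set.Ici 0) := by
  intro r hr
  have hr' : (0 : ℝ) ≤ r := hr
  have hz : rayPoint c φ r - z ≠ 0 :=
    norm_pos_iff.1 ((by positivity : 0 < m * (1 + r)).trans_le (h2 r hr))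
  exact ((hasDerivAt_cauchyPow α (neg_rayPoint_mem_slitPlane hc hφ hr) hz).continuousAt.comp
    (continuous_rayPoint c φ).continuousAt).continuousWithinAt

theorem integrableOn_cauchyPow {c m : ℝ} (hα : 0 < α) (hc : 0 < c) (hm : 0 < m)
    (hφ : Real.sin φ ≠ 0) (h1 : ∀ r, 0 ≤ r → m * (1 + r) ≤ ‖rayPoint c φ r‖)
    (h2 : ∀ r, 0 ≤ r → m * (1 + r) ≤ ‖rayPoint c φ r - z‖) :
    IntegrableOn (fun r => Complex.exp (φ * Complex.I) * cauchyPow α z (rayPoint c φ r))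
      (Set.Ioi 0) := by
  refine (integrableOn_mul_one_add_rpow one_pos hm (s := -α - 1) (by linarith)).mono'
    (ContinuousOn.aestronglyMeasurable ?_ measurableSet_Ioi) ?_
  · exact continuousOn_const.mul
      ((continuousOn_cauchyPow_rayPoint hc hm hφ h2).mono Set.Ioi_subset_Ici_self)
  · refine (ae_restrict_mem measurableSet_Ioi).mono fun r hr => ?_
    have hr' : (0 : ℝ) < r := hr
    rw [norm_mul, Complex.norm_exp_ofReal_mul_I, one_mul]
    exact norm_cauchyPow_le hα.le (by positivity) (h1 r hr'.le) (h2 r hr'.le)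

/-- Moving the vertex of the ray changes the integral at a rate that does not depend on the
direction of the ray. -/
theorem hasDerivAt_rayIntegral_cauchyPow {c m : ℝ} (hα : 0 < α) (hc : 1 ≤ c) (hm : 0 < m)
    (hφ : Real.sin φ ≠ 0)
    (h1 : ∀ c' ∈ Metric.ball c (1 / 2), ∀ r, 0 ≤ r → m * (1 + r) ≤ ‖rayPoint c' φ r‖)
    (h2 : ∀ c' ∈ Metric.ball c (1 / 2), ∀ r, 0 ≤ r → m * (1 + r) ≤ ‖rayPoint c' φ r - z‖) :
    HasDerivAt (rayIntegral (cauchyPow α z) φ) (cauchyPow α z (-c)) c := by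
  set E := Complex.exp (φ * Complex.I) with hE
  have hEn : ‖E‖ = 1 := Complex.norm_exp_ofReal_mul_I φ
  set f' : ℂ → ℂ := fun μ => (negPow α μ * (-α / μ) * (μ - z) - negPow α μ * 1) / (μ - z) ^ 2
    with hf'
  have hball : ∀ c' ∈ Metric.ball c (1 / 2 : ℝ), 0 < c' := fun c' hc' => by
    rw [Real.ball_eq_Ioo] at hc'
    linarith [hc'.1]
  have hcc : c ∈ Metric.ball c (1 / 2 : ℝ) := Metric.mem_ball_self (by norm_num)
  have hder : ∀ c' ∈ Metric.ball c (1 / 2 : ℝ), ∀ r, 0 ≤ r →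
      HasDerivAt (cauchyPow α z) (f' (rayPoint c' φ r)) (rayPoint c' φ r) := fun c' hc' r hr =>
    hasDerivAt_cauchyPow α (neg_rayPoint_mem_slitPlane (hball c' hc') hφ hr)
      (norm_pos_iff.1 ((by positivity : 0 < m * (1 + r)).trans_le (h2 c' hc' r hr)))
  -- Differentiating the integrand in `c` gives `-E f'`, which is also the `r`-derivative of
  -- `-cauchyPow` along the ray. Its integral therefore telescopes to the value at the vertex, where
  -- `φ` no longer appears.
  have hderR : ∀ r ∈ Set.Ici (0 : ℝ), HasDerivAt (fun r => -cauchyPow α z (rayPoint c φ r))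
      (-E * f' (rayPoint c φ r)) r := fun r hr => by
    have := (hder c hcc r hr).comp r (hasDerivAt_rayPoint_right c φ r)
    refine this.neg.congr_deriv ?_
    rw [← hE]; ring
  have hmeas : AEStronglyMeasurable (fun r => -E * f' (rayPoint c φ r))
      (volume.restrict (Set.Ioi 0)) := by
    refine ContinuousOn.aestronglyMeasurable (fun r hr => ?_) measurableSet_Ioi
    have hr' : (0 : ℝ) < r := hr
    have hs := neg_rayPoint_mem_slitPlane (hball c hcc) hφ hr'.le
    have hz : rayPoint c φ r - z ≠ 0 :=
      norm_pos_iff.1 ((by positivity : 0 < m * (1 + r)).trans_le (h2 c hcc r hr'.le))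
    have h0 : rayPoint c φ r ≠ 0 :=
      norm_pos_iff.1 ((by positivity : 0 < m * (1 + r)).trans_le (h1 c hcc r hr'.le))
    have hcn := (hasDerivAt_negPow α hs).continuousAt
    have : ContinuousAt f' (rayPoint c φ r) := by
      refine ContinuousAt.div ?_ (by fun_prop) (pow_ne_zero 2 hz)
      exact ((hcn.mul (continuousAt_const.div continuousAt_id h0)).mul (by fun_prop)).sub
        (hcn.mul continuousAt_const)
    exact (continuousAt_const.mul
      (this.comp (continuous_rayPoint c φ).continuousAt)).continuousWithinAt
  have hmain := hasDerivAt_integral_of_dominated_loc_of_deriv_le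
    (μ := volume.restrict (Set.Ioi (0 : ℝ)))
    (F := fun c r => E * cauchyPow α z (rayPoint c φ r))
    (F' := fun c r => -E * f' (rayPoint c φ r))
    (bound := fun r => (α + 1) * (m * (1 + r)) ^ (-α - 2))
    (Metric.ball_mem_nhds c (by norm_num : (0 : ℝ) < 1 / 2))
    (by
      filter_upwards [Metric.ball_mem_nhds c (by norm_num : (0 : ℝ) < 1 / 2)] with c' hc'
      exact (integrableOn_cauchyPow hα (hball c' hc') hm hφ (h1 c' hc')
        (h2 c' hc')).aestronglyMeasurable)
    (integrableOn_cauchyPow hα (hball c hcc) hm hφ (h1 c hcc) (h2 c hcc))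
    hmeas
    ((ae_restrict_mem measurableSet_Ioi).mono fun r hr c' hc' => by
      have hr' : (0 : ℝ) < r := hr
      rw [norm_mul, norm_neg, hEn, one_mul]
      exact norm_deriv_cauchyPow_le hα.le (by positivity) (h1 c' hc' r hr'.le) (h2 c' hc' r hr'.le))
    ((integrableOn_mul_one_add_rpow one_pos hm (by linarith)).const_mul _)
    ((ae_restrict_mem measurableSet_Ioi).mono fun r hr c' hc' => by
      have hr' : (0 : ℝ) < r := hr
      have := ((hder c' hc' r hr'.le).comp c' (hasDerivAt_rayPoint_left φ r c')).const_mul E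
      refine this.congr_deriv ?_
      ring)
  have htend : Tendsto (fun r => -cauchyPow α z (rayPoint c φ r)) atTop (𝓝 0) := by
    have h0 : Tendsto (fun r : ℝ => (m * (1 + r)) ^ (-α - 1)) atTop (𝓝 0) := by
      have e1 : Tendsto (fun r : ℝ => m * (1 + r)) atTop atTop :=
        (tendsto_atTop_add_const_left _ _ tendsto_id).const_mul_atTop hm
      have e2 := (tendsto_rpow_neg_atTop (by linarith : 0 < α + 1)).comp e1
      refine e2.congr fun r => ?_
      simp only [Function.comp, neg_add']
    refine squeeze_zero_norm' ?_ h0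
    filter_upwards [eventually_ge_atTop 0] with r hr
    rw [norm_neg]
    exact norm_cauchyPow_le hα.le (by positivity) (h1 c hcc r hr) (h2 c hcc r hr)
  have hval := integral_Ioi_of_hasDerivAt_of_tendsto' hderR hmain.1 htend
  have hval' : ∫ r in Set.Ioi (0 : ℝ), -E * f' (rayPoint c φ r) = cauchyPow α z (-c) := by
    rw [hval, zero_sub, neg_neg]
    congr 1
    simp [rayPoint]
  have h := hmain.2
  rw [hval'] at h
  exact h

end Cauchy

/-- A bound for the Cauchy integral of `μ^{-α}` along the two rays from `-1`, obtained by moving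
the vertex to `-|Im z|`. -/
theorem exists_norm_rayIntegral_sub_le {α θ : ℝ} (hα : 0 < α) (hs : Real.sin θ ≠ 0)
    (hθ : |Real.sin θ| < Real.cos θ) :
    ∃ K m : ℝ, 0 < m ∧ 0 ≤ K ∧ ∀ z : ℂ, z.re ≤ -2 → -|z.im| ≤ z.re →
      (∀ φ : ℝ, (φ = θ ∨ φ = -θ) → ∀ r, 0 ≤ r →
        m * (1 + r) ≤ ‖rayPoint 1 φ r‖ ∧ m * (1 + r) ≤ ‖rayPoint 1 φ r - z‖) ∧
      ‖rayIntegral (cauchyPow α z) θ 1 - rayIntegral (cauchyPow α z) (-θ) 1‖ ≤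
        K * |z.im| ^ (-α) := by
  have hcos : Real.cos θ < 1 := by
    have := Real.sin_sq_add_cos_sq θ
    have := sq_pos_of_ne_zero hs
    nlinarith [Real.neg_one_le_cos θ]
  obtain ⟨k₁, hk₁, H₁⟩ := exists_mul_le_norm_rayPoint hcos
  obtain ⟨k₂, hk₂, H₂⟩ := exists_mul_le_norm_rayPoint (φ := -θ) (by rwa [Real.cos_neg])
  obtain ⟨k₃, hk₃, H₃⟩ := exists_mul_le_norm_rayPoint_sub hθ
  obtain ⟨k₄, hk₄, H₄⟩ := exists_mul_le_norm_rayPoint_sub (φ := -θ)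
    (by rwa [Real.cos_neg, Real.sin_neg, abs_neg])
  set k := min (min k₁ k₂) (min k₃ k₄) with hk
  have hkpos : 0 < k := by simp [hk, hk₁, hk₂, hk₃, hk₄]
  have hkl : k ≤ k₁ ∧ k ≤ k₂ ∧ k ≤ k₃ ∧ k ≤ k₄ := by
    refine ⟨?_, ?_, ?_, ?_⟩ <;> simp [hk]
  have G₁ : ∀ φ : ℝ, (φ = θ ∨ φ = -θ) → ∀ c r : ℝ, 0 ≤ c → 0 ≤ r →
      k * (c + r) ≤ ‖rayPoint c φ r‖ := by
    rintro φ (rfl | rfl) c r hc hr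
    · exact (mul_le_mul_of_nonneg_right hkl.1 (by positivity)).trans (H₁ c r hc hr)
    · exact (mul_le_mul_of_nonneg_right hkl.2.1 (by positivity)).trans (H₂ c r hc hr)
  have G₂ : ∀ φ : ℝ, (φ = θ ∨ φ = -θ) → ∀ (z : ℂ) (c r : ℝ), |c + z.re| ≤ |z.im| → 0 ≤ r →
      k * (|z.im| + r) ≤ ‖rayPoint c φ r - z‖ := by
    rintro φ (rfl | rfl) z c r hc hr
    · exact (mul_le_mul_of_nonneg_right hkl.2.2.1 (by positivity)).trans (H₃ z c r hc hr)
    · exact (mul_le_mul_of_nonneg_right hkl.2.2.2 (by positivity)).trans (H₄ z c r hc hr)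
  have hsin : ∀ φ : ℝ, (φ = θ ∨ φ = -θ) → Real.sin φ ≠ 0 := by
    rintro φ (rfl | rfl)
    · exact hs
    · simpa using hs
  -- Halving `k` allows vertices `-c` with `c > 1/2`: the derivative lemma needs its bounds on a
  -- ball of radius `1/2` around each `c ∈ [1, |Im z|]`.
  refine ⟨2 * (k ^ (-α - 1) / α), k / 2, by positivity, by positivity, fun z hz1 hz2 => ?_⟩
  have hb : 2 ≤ |z.im| := by linarith
  have B₁ : ∀ φ : ℝ, (φ = θ ∨ φ = -θ) → ∀ c : ℝ, 1 / 2 < c → ∀ r, 0 ≤ r →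
      k / 2 * (1 + r) ≤ ‖rayPoint c φ r‖ := by
    intro φ hφ c hc r hr
    refine le_trans ?_ (G₁ φ hφ c r (by linarith) hr)
    nlinarith [mul_nonneg hkpos.le hr]
  have B₂ : ∀ φ : ℝ, (φ = θ ∨ φ = -θ) → ∀ c : ℝ, 1 / 2 < c → c < |z.im| + 1 / 2 → ∀ r, 0 ≤ r →
      k / 2 * (1 + r) ≤ ‖rayPoint c φ r - z‖ := by
    intro φ hφ c hc hc' r hr
    refine le_trans ?_ (G₂ φ hφ z c r (abs_le.2 ⟨by linarith, by linarith⟩) hr)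
    nlinarith [mul_nonneg hkpos.le hr]
  refine ⟨fun φ hφ r hr => ⟨B₁ φ hφ 1 (by norm_num) r hr,
    B₂ φ hφ 1 (by norm_num) (by linarith) r hr⟩, ?_⟩
  have hder : ∀ φ : ℝ, (φ = θ ∨ φ = -θ) → ∀ c ∈ Set.Icc 1 |z.im|,
      HasDerivAt (rayIntegral (cauchyPow α z) φ) (cauchyPow α z (-c)) c := by
    intro φ hφ c hc
    refine hasDerivAt_rayIntegral_cauchyPow hα hc.1 (half_pos hkpos) (hsin φ hφ)
      (fun c' hc' => ?_) (fun c' hc' => ?_)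
    · rw [Real.ball_eq_Ioo] at hc'
      exact B₁ φ hφ c' (by linarith [hc'.1, hc.1])
    · rw [Real.ball_eq_Ioo] at hc'
      exact B₂ φ hφ c' (by linarith [hc'.1, hc.1]) (by linarith [hc'.2, hc.2])
  -- The two rays change at the same rate, so their difference is constant in `c`; this plays the
  -- role of Cauchy's theorem on the unbounded region between the contours.
  have hder' : ∀ c ∈ Set.Icc 1 |z.im|, HasDerivAt (fun c => rayIntegral (cauchyPow α z) θ c -
      rayIntegral (cauchyPow α z) (-θ) c) 0 c := fun c hc => by
    simpa using! (hder θ (.inl rfl) c hc).sub (hder (-θ) (.inr rfl) c hc)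
  have hconst := constant_of_has_deriv_right_zero
    (fun c hc => (hder' c hc).continuousAt.continuousWithinAt)
    (fun c hc => (hder' c (Set.Ico_subset_Icc_self hc)).hasDerivWithinAt) |z.im|
    ⟨by linarith, le_rfl⟩
  rw [← hconst]
  -- With the vertex at `-|Im z|`, both `|μ|` and `|μ - z|` are at least `k(|Im z| + r)`, and
  -- integrating in `r` yields the power `|Im z|^{-α}`.
  have hbound : ∀ φ : ℝ, (φ = θ ∨ φ = -θ) →
      ‖rayIntegral (cauchyPow α z) φ |z.im|‖ ≤ k ^ (-α - 1) / α * |z.im| ^ (-α) := by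
    intro φ hφ
    rw [← integral_mul_add_rpow (by linarith) hkpos hα]
    refine norm_integral_le_of_norm_le
      (integrableOn_mul_one_add_rpow (by linarith) hkpos (by linarith)) ?_
    refine (ae_restrict_mem measurableSet_Ioi).mono fun r hr => ?_
    have hr' : (0 : ℝ) < r := hr
    rw [norm_mul, Complex.norm_exp_ofReal_mul_I, one_mul]
    exact norm_cauchyPow_le hα.le (by positivity) (G₁ φ hφ _ r (by linarith) hr'.le)
      (G₂ φ hφ z _ r (abs_le.2 ⟨by linarith, by linarith⟩) hr'.le)
  calc _ ≤ _ := norm_sub_le _ _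
    _ ≤ _ := add_le_add (hbound θ (.inl rfl)) (hbound (-θ) (.inr rfl))
    _ = _ := by ring

end UnboundedOperator

/-! ### Decay of the resolvent on the fractional domain. -/

namespace UnboundedOperator

variable {X : Type*} [NormedAddCommGroup X] [NormedSpace ℂ X] {A : X →ₗ.[ℂ] X}

/-- If the operators `R(z) P`, `z ∈ S`, are uniformly bounded and `P` commutes with a resolvent
with dense range, then `R(z) P y` tends to `0` as `|Im z| → ∞` in `S`. -/
theorem exists_norm_resolvent_comp_le {P : X → X} {S : Set ℂ} (hS : S ⊆ resolventSet A) {μ : ℂ}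
    (hμ : μ ∈ resolventSet A) (hd : DenseRange (resolvent A μ))
    (hsub : ∀ x y, P (x - y) = P x - P y)
    (hcomm : ∀ x, P (resolvent A μ x) = resolvent A μ (P x)) {K : ℝ}
    (hK : ∀ z ∈ S, ∀ y, ‖resolvent A z (P y)‖ ≤ K * ‖y‖) (y : X) {ε : ℝ} (hε : 0 < ε) :
    ∃ B : ℝ, ∀ z ∈ S, B ≤ |z.im| → ‖resolvent A z (P y)‖ ≤ ε := by
  obtain ⟨v, hv⟩ := hd.exists_dist_lt y (show 0 < ε / (2 * (|K| + 1)) by positivity)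
  rw [dist_eq_norm] at hv
  set D := |K| * ‖v‖ + ‖resolvent A μ (P v)‖ with hD
  have hD0 : 0 ≤ D := by positivity
  -- This forces `‖μ - z‖ ≥ 2D/ε + 1`; on the range of `R(μ)` the resolvent identity bounds the norm
  -- by `D/‖μ - z‖`. The `+ 1` keeps the divisor positive when `D = 0`.
  refine ⟨|μ.im| + 2 * D / ε + 1, fun z hz hB => ?_⟩
  have h1 : ‖resolvent A z (P (y - resolvent A μ v))‖ ≤ ε / 2 := by
    refine (hK z hz _).trans ?_
    calc K * ‖y - resolvent A μ v‖ ≤ (|K| + 1) * (ε / (2 * (|K| + 1))) := by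
          refine mul_le_mul ?_ hv.le (norm_nonneg _) (by positivity)
          linarith [le_abs_self K]
      _ = ε / 2 := by field_simp
  have h2 : ‖resolvent A z (P (resolvent A μ v))‖ ≤ ε / 2 := by
    rw [hcomm]
    have e1 := congrArg norm (resolvent_sub_apply (hS hz) hμ (P v))
    rw [norm_smul] at e1
    have e2 : ‖resolvent A z (P v) - resolvent A μ (P v)‖ ≤ D := by
      refine (norm_sub_le _ _).trans (add_le_add_left ((hK z hz v).trans ?_) _)
      exact mul_le_mul_of_nonneg_right (le_abs_self K) (norm_nonneg _)
    have e3 : 2 * D / ε + 1 ≤ ‖μ - z‖ := by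
      have := Complex.abs_im_le_norm (μ - z)
      rw [Complex.sub_im] at this
      have := abs_sub_abs_le_abs_sub z.im μ.im
      rw [abs_sub_comm] at this
      linarith
    rw [e1] at e2
    have e4 : (2 * D / ε + 1) * ‖resolvent A z (resolvent A μ (P v))‖ ≤ D :=
      (mul_le_mul_of_nonneg_right e3 (norm_nonneg _)).trans e2
    have e5 : (2 * D / ε + 1) * (ε / 2) = D + ε / 2 := by field_simp
    have e6 : 0 < 2 * D / ε + 1 := by positivity
    refine le_of_mul_le_mul_left ?_ e6
    rw [e5]
    linarith
  have h3 : P y = P (y - resolvent A μ v) + P (resolvent A μ v) := by rw [hsub]; abel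
  rw [h3, map_add]
  exact (norm_add_le _ _).trans (by linarith)

/-- The integrand in the definition of `A_ω^{-α}`. -/
def rayIntegrand (A : X →ₗ.[ℂ] X) (ω α φ : ℝ) (y : X) (r : ℝ) : X :=
  Complex.exp (φ * Complex.I) •
    (negPow α (rayPoint 1 φ r) • resolvent A (rayPoint 1 φ r + ω) y)

theorem fracNegPower_of_ne_zero (A : X →ₗ.[ℂ] X) (ω θ : ℝ) {α : ℝ} (hα : α ≠ 0) (y : X) :
    fracNegPower A ω θ α y = (2 * Real.pi * Complex.I)⁻¹ •
      ((∫ r in Set.Ioi (0 : ℝ), rayIntegrand A ω α θ y r) -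
        ∫ r in Set.Ioi (0 : ℝ), rayIntegrand A ω α (-θ) y r) := by
  rw [fracNegPower, if_neg hα]
  simp only [rayIntegrand, rayPoint, Complex.ofReal_one, Complex.ofReal_neg]

section Ray

variable {M w ω : ℝ} (hρ : ∀ u : ℂ, w < u.re → u ∈ resolventSet A)
  (hR : ∀ u : ℂ, w < u.re → ‖resolvent A u‖ ≤ M / (u.re - w)) (hM : 0 ≤ M) (hω : w + 3 < ω)
  {φ m : ℝ} (hm : 0 < m) (hmc : m ≤ Real.cos φ)

include hmc hω in
-- This is where the margin `3` is spent: shifting by `-1` still leaves more than `2`, and `m ≤ cos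
-- φ ≤ 1`. The summand `1` gives a uniform resolvent bound, the rest gives decay in `r`.
theorem le_rayPoint_add_re_sub {r : ℝ} (hr : 0 ≤ r) :
    1 + m * (1 + r) ≤ (rayPoint 1 φ r + ω).re - w := by
  rw [Complex.add_re, rayPoint_re, Complex.ofReal_re]
  nlinarith [Real.cos_le_one φ, mul_nonneg (sub_nonneg.2 hmc) hr]

include hρ hR hM in
theorem differentiableOn_resolvent_halfPlane (y : X) :
    DifferentiableOn ℂ (fun u => resolvent A u y) {u : ℂ | w < u.re} := by
  have hopen : ∀ a : ℝ, IsOpen {u : ℂ | a < u.re} := fun a =>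
    isOpen_lt continuous_const Complex.continuous_re
  refine differentiableOn_resolvent_apply (hopen w) hρ (fun z hz => ?_) y
  have hz' : w < z.re := hz
  refine ⟨M / ((z.re - w) / 2), ?_⟩
  filter_upwards [(hopen ((z.re + w) / 2)).mem_nhds (show (z.re + w) / 2 < z.re by linarith)]
    with u hu
  have hu' : (z.re + w) / 2 < u.re := hu
  refine (hR u (by linarith)).trans ?_
  gcongr
  linarith

include hρ hR hM hω hm hmc in
theorem continuousOn_resolvent_rayPoint (y : X) :
    ContinuousOn (fun r => resolvent A (rayPoint 1 φ r + ω) y) (Set.Ici 0) := by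
  refine (differentiableOn_resolvent_halfPlane hρ hR hM y).continuousOn.comp
    ((continuous_rayPoint 1 φ).add continuous_const).continuousOn fun r hr => ?_
  have hr' : (0 : ℝ) ≤ r := hr
  have := le_rayPoint_add_re_sub hω hmc hr'
  have : 0 ≤ m * (1 + r) := by positivity
  show w < _
  linarith

include hR hM hω hm hmc in
theorem norm_resolvent_rayPoint_le {r : ℝ} (hr : 0 ≤ r) (y : X) :
    ‖resolvent A (rayPoint 1 φ r + ω) y‖ ≤ M / (1 + m * (1 + r)) * ‖y‖ := by
  have h1 := le_rayPoint_add_re_sub hω hmc hr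
  have h2 : 0 ≤ m * (1 + r) := by positivity
  refine ContinuousLinearMap.le_of_opNorm_le _ ((hR _ (by linarith)).trans ?_) y
  gcongr

variable {α : ℝ} (hα : 0 < α) (hs : Real.sin φ ≠ 0)
  (hm1 : ∀ r, 0 ≤ r → m * (1 + r) ≤ ‖rayPoint 1 φ r‖)

include hρ hR hM hω hm hmc hα hs hm1 in
theorem integrableOn_rayIntegrand (y : X) :
    IntegrableOn (rayIntegrand A ω α φ y) (Set.Ioi 0) := by
  refine ((integrableOn_mul_one_add_rpow one_pos hm (s := -α - 1) (by linarith)).const_mul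
    (M * ‖y‖)).mono' (ContinuousOn.aestronglyMeasurable ?_ measurableSet_Ioi) ?_
  · refine continuousOn_const.smul (ContinuousOn.smul (fun r hr => ?_)
      ((continuousOn_resolvent_rayPoint hρ hR hM hω hm hmc y).mono Set.Ioi_subset_Ici_self))
    have hr' : (0 : ℝ) < r := hr
    exact ((hasDerivAt_negPow α (neg_rayPoint_mem_slitPlane one_pos hs
      hr'.le)).continuousAt.comp (continuous_rayPoint 1 φ).continuousAt).continuousWithinAt
  · refine (ae_restrict_mem measurableSet_Ioi).mono fun r hr => ?_
    have hr' : (0 : ℝ) < r := hr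
    have hpos : 0 < m * (1 + r) := by positivity
    have h1 := hm1 r hr'.le
    rw [rayIntegrand, norm_smul, norm_smul, Complex.norm_exp_ofReal_mul_I, one_mul,
      norm_negPow α (norm_pos_iff.1 (hpos.trans_le h1)), Real.rpow_sub_one hpos.ne']
    have h2 : ‖rayPoint 1 φ r‖ ^ (-α) ≤ (m * (1 + r)) ^ (-α) :=
      Real.rpow_le_rpow_of_nonpos hpos h1 (by linarith)
    have h3 : ‖resolvent A (rayPoint 1 φ r + ω) y‖ ≤ M / (m * (1 + r)) * ‖y‖ := by
      refine (norm_resolvent_rayPoint_le hR hM hω hm hmc hr'.le y).trans ?_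
      gcongr
      linarith
    calc _ ≤ (m * (1 + r)) ^ (-α) * (M / (m * (1 + r)) * ‖y‖) :=
          mul_le_mul h2 h3 (norm_nonneg _) (Real.rpow_nonneg hpos.le _)
      _ = _ := by ring

include hρ hR hM hω hm hmc hα hs hm1 in
theorem rayIntegral_sub (x y : X) : ∫ r in Set.Ioi (0 : ℝ), rayIntegrand A ω α φ (x - y) r =
    (∫ r in Set.Ioi (0 : ℝ), rayIntegrand A ω α φ x r) -
      ∫ r in Set.Ioi (0 : ℝ), rayIntegrand A ω α φ y r := by
  rw [← integral_sub (integrableOn_rayIntegrand hρ hR hM hω hm hmc hα hs hm1 x)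
    (integrableOn_rayIntegrand hρ hR hM hω hm hmc hα hs hm1 y)]
  simp only [rayIntegrand, map_sub, smul_sub]

include hρ hR hM hω hm hmc hα hs hm1 in
theorem rayIntegral_resolvent [CompleteSpace X] {μ : ℂ} (hμ : μ ∈ resolventSet A) (y : X) :
    ∫ r in Set.Ioi (0 : ℝ), rayIntegrand A ω α φ (resolvent A μ y) r =
      resolvent A μ (∫ r in Set.Ioi (0 : ℝ), rayIntegrand A ω α φ y r) := by
  rw [← ContinuousLinearMap.integral_comp_comm _
    (integrableOn_rayIntegrand hρ hR hM hω hm hmc hα hs hm1 y)]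
  refine setIntegral_congr_fun measurableSet_Ioi fun r hr => ?_
  have hr' : (0 : ℝ) < r := hr
  have h1 := le_rayPoint_add_re_sub hω hmc hr'.le
  have h2 : 0 ≤ m * (1 + r) := by positivity
  simp only [rayIntegrand, map_smul]
  rw [resolvent_comm (hρ _ (by linarith)) hμ]

include hρ hR hM hω hm hmc hα hs hm1 in
-- By the resolvent identity the difference is minus the integral of `cauchyPow` against `R(μ+ω)y`.
-- Here `R(μ+ω)` is bounded by `M`, and the bound does not depend on `z`.
theorem norm_resolvent_rayIntegral_sub_le [CompleteSpace X] {z : ℂ} (hz : z ∈ resolventSet A)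
    (h2 : ∀ r, 0 ≤ r → m * (1 + r) ≤ ‖rayPoint 1 φ r - (z - ω)‖) (y : X) :
    ‖resolvent A z (∫ r in Set.Ioi (0 : ℝ), rayIntegrand A ω α φ y r) -
      rayIntegral (cauchyPow α (z - ω)) φ 1 • resolvent A z y‖ ≤
        M * (m ^ (-α - 1) / α) * ‖y‖ := by
  have hI := integrableOn_cauchyPow (z := z - ω) hα one_pos hm hs hm1 h2
  rw [← ContinuousLinearMap.integral_comp_comm _
    (integrableOn_rayIntegrand hρ hR hM hω hm hmc hα hs hm1 y), rayIntegral,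
    ← integral_smul_const, ← integral_sub ((resolvent A z).integrable_comp
    (integrableOn_rayIntegrand hρ hR hM hω hm hmc hα hs hm1 y)) (hI.smul_const _)]
  have hval := integral_mul_add_rpow one_pos hm hα
  rw [Real.one_rpow, mul_one] at hval
  have hbound : M * (m ^ (-α - 1) / α) * ‖y‖ =
      ∫ r in Set.Ioi (0 : ℝ), (m * (1 + r)) ^ (-α - 1) * (M * ‖y‖) := by
    rw [integral_mul_const, hval]
    ring
  rw [hbound]
  refine norm_integral_le_of_norm_le ((integrableOn_mul_one_add_rpow one_pos hm
    (by linarith)).mul_const _) ((ae_restrict_mem measurableSet_Ioi).mono fun r hr => ?_)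
  have hr' : (0 : ℝ) < r := hr
  have hpos : 0 < m * (1 + r) := by positivity
  have hre := le_rayPoint_add_re_sub hω hmc hr'.le
  have hne : rayPoint 1 φ r - (z - ω) ≠ 0 := norm_pos_iff.1 (hpos.trans_le (h2 r hr'.le))
  have e1 := resolvent_sub_apply hz (hρ (rayPoint 1 φ r + ω) (by linarith)) y
  have e2 : resolvent A z (rayIntegrand A ω α φ y r) -
      (Complex.exp (φ * Complex.I) * cauchyPow α (z - ω) (rayPoint 1 φ r)) • resolvent A z y =
      -((Complex.exp (φ * Complex.I) * cauchyPow α (z - ω) (rayPoint 1 φ r)) •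
        resolvent A (rayPoint 1 φ r + ω) y) := by
    have e3 : resolvent A z (rayIntegrand A ω α φ y r) =
        (Complex.exp (φ * Complex.I) * cauchyPow α (z - ω) (rayPoint 1 φ r)) •
          (resolvent A z y - resolvent A (rayPoint 1 φ r + ω) y) := by
      rw [e1, rayIntegrand, map_smul, map_smul, smul_smul, smul_smul]
      congr 1
      rw [cauchyPow]
      have e4 : rayPoint 1 φ r + ω - z = rayPoint 1 φ r - (z - ω) := by ring
      rw [e4]
      field_simp
    rw [e3, smul_sub]
    abel
  rw [e2, norm_neg, norm_smul, norm_mul, Complex.norm_exp_ofReal_mul_I, one_mul]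
  refine mul_le_mul (norm_cauchyPow_le hα.le hpos (hm1 r hr'.le) (h2 r hr'.le)) ?_
    (norm_nonneg _) (Real.rpow_nonneg hpos.le _)
  refine (norm_resolvent_rayPoint_le hR hM hω hm hmc hr'.le y).trans ?_
  gcongr
  exact div_le_self hM (by linarith)

end Ray

/-- Decay along a strip of the resolvent on the range of `A_ω^{-α}`, given polynomial growth of
order `α` of the resolvent. -/
theorem exists_norm_resolvent_le_of_mem_fracDomain [CompleteSpace X] {M w ω θ α s h C : ℝ}
    (hρ : ∀ u : ℂ, w < u.re → u ∈ resolventSet A)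
    (hR : ∀ u : ℂ, w < u.re → ‖resolvent A u‖ ≤ M / (u.re - w)) (hM : 0 ≤ M) (hω : w + 3 < ω)
    (hd : ∀ u : ℂ, w < u.re → DenseRange (resolvent A u))
    (hθ₀ : 0 < θ) (hθ : θ < Real.pi / 6) (hα : 0 ≤ α) (hsh : s < h)
    (hsρ : ∀ z : ℂ, s < z.re → z ∈ resolventSet A)
    (hC : ∀ z : ℂ, s < z.re → ‖resolvent A z‖ / (1 + |z.im| ^ α) ≤ C)
    {x : X} (hx : x ∈ fracDomain A ω θ α) {ε : ℝ} (hε : 0 < ε) :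
    ∃ B : ℝ, ∀ z : ℂ, h ≤ z.re → z.re ≤ ω - 2 → B ≤ |z.im| → ‖resolvent A z x‖ ≤ ε := by
  obtain ⟨y, rfl⟩ := hx
  have hμ : w < ((w + 1 : ℝ) : ℂ).re := by simp
  have hC' : ∀ z : ℂ, s < z.re → 1 ≤ |z.im| → ‖resolvent A z‖ ≤ 2 * |C| * |z.im| ^ α := by
    intro z hz h1
    have h2 := hC z hz
    have h3 : 1 ≤ |z.im| ^ α := Real.one_le_rpow h1 hα
    rw [div_le_iff₀ (by positivity)] at h2
    nlinarith [le_abs_self C, abs_nonneg C, mul_nonneg (abs_nonneg C) (sub_nonneg.2 h3),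
      mul_nonneg (sub_nonneg.2 (le_abs_self C)) (by positivity : 0 ≤ 1 + |z.im| ^ α)]
  -- The lower bound `1` turns `1 + |Im z|^α` into a multiple of `|Im z|^α`; the bound `ω - h`
  -- places `z - ω` in the region `-|Im| ≤ Re ≤ -2` of the scalar estimate.
  set S : Set ℂ := {z | h ≤ z.re ∧ z.re ≤ ω - 2 ∧ max 1 (ω - h) ≤ |z.im|} with hS
  have hSρ : S ⊆ resolventSet A := fun z hz => hsρ z (hsh.trans_le hz.1)
  suffices H : ∃ B : ℝ, ∀ z ∈ S, B ≤ |z.im| → ‖resolvent A z (fracNegPower A ω θ α y)‖ ≤ ε by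
    obtain ⟨B, hB⟩ := H
    exact ⟨max B (max 1 (ω - h)), fun z h1 h2 h3 =>
      hB z ⟨h1, h2, (le_max_right _ _).trans h3⟩ ((le_max_left _ _).trans h3)⟩
  rcases hα.eq_or_lt with rfl | hα
  · refine exists_norm_resolvent_comp_le (P := fracNegPower A ω θ 0) hSρ (hρ _ hμ) (hd _ hμ)
      (fun x y => by simp [fracNegPower]) (fun x => by simp [fracNegPower])
      (K := 2 * |C|) (fun z hz y => ?_) y hε
    have h1 := hC' z (hsh.trans_le hz.1) ((le_max_left _ _).trans hz.2.2)
    rw [Real.rpow_zero, mul_one] at h1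
    simpa [fracNegPower] using (resolvent A z).le_of_opNorm_le h1 y
  have hsin : 0 < Real.sin θ := Real.sin_pos_of_pos_of_lt_pi hθ₀ (by linarith [Real.pi_pos])
  have hsc : |Real.sin θ| < Real.cos θ := by
    rw [abs_of_pos hsin, ← Real.sin_pi_div_two_sub]
    exact Real.sin_lt_sin_of_lt_of_le_pi_div_two (by linarith [Real.pi_pos]) (by linarith)
      (by linarith [Real.pi_pos])
  have hcos : 0 < Real.cos θ := (abs_nonneg _).trans_lt hsc
  obtain ⟨K, m₀, hm₀, hK, H⟩ := exists_norm_rayIntegral_sub_le hα hsin.ne' hsc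
  set m := min m₀ (Real.cos θ) with hm_def
  have hm : 0 < m := lt_min hm₀ hcos
  have hmc : ∀ φ : ℝ, (φ = θ ∨ φ = -θ) → m ≤ Real.cos φ := by
    rintro φ (rfl | rfl)
    · exact min_le_right _ _
    · rw [Real.cos_neg]; exact min_le_right _ _
  have hs : ∀ φ : ℝ, (φ = θ ∨ φ = -θ) → Real.sin φ ≠ 0 := by
    rintro φ (rfl | rfl)
    · exact hsin.ne'
    · simpa using hsin.ne'
  have hm1 : ∀ φ : ℝ, (φ = θ ∨ φ = -θ) → ∀ r, 0 ≤ r → m * (1 + r) ≤ ‖rayPoint 1 φ r‖ := by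
    intro φ hφ r hr
    -- The bound on `‖rayPoint 1 φ r‖` does not involve `z`; any admissible point extracts it.
    refine le_trans ?_ ((H (-2 + 2 * Complex.I) (by simp) (by simp)).1 φ hφ r hr).1
    gcongr
    exact min_le_left _ _
  have hm2 : ∀ z ∈ S, ∀ φ : ℝ, (φ = θ ∨ φ = -θ) → ∀ r, 0 ≤ r →
      m * (1 + r) ≤ ‖rayPoint 1 φ r - (z - ω)‖ := by
    intro z hz φ hφ r hr
    have h1 := (le_max_right _ _).trans hz.2.2
    refine le_trans ?_ ((H (z - ω) (by simp; linarith [hz.2.1])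
      (by simp; linarith [hz.1])).1 φ hφ r hr).2
    gcongr
    exact min_le_left _ _
  have hint := fun φ hφ y => integrableOn_rayIntegrand hρ hR hM hω hm (hmc φ hφ) hα (hs φ hφ)
    (hm1 φ hφ) y
  refine exists_norm_resolvent_comp_le (P := fracNegPower A ω θ α) hSρ (hρ _ hμ) (hd _ hμ)
    (fun x y => ?_) (fun x => ?_)
    (K := ‖(2 * Real.pi * Complex.I : ℂ)⁻¹‖ * (2 * (M * (m ^ (-α - 1) / α)) + K * (2 * |C|)))
    (fun z hz y => ?_) y hε
  · simp only [fracNegPower_of_ne_zero A ω θ hα.ne']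
    rw [rayIntegral_sub hρ hR hM hω hm (hmc θ (.inl rfl)) hα (hs θ (.inl rfl)) (hm1 θ (.inl rfl)),
      rayIntegral_sub hρ hR hM hω hm (hmc (-θ) (.inr rfl)) hα (hs (-θ) (.inr rfl))
        (hm1 (-θ) (.inr rfl)), ← smul_sub]
    congr 1
    abel
  · simp only [fracNegPower_of_ne_zero A ω θ hα.ne']
    rw [rayIntegral_resolvent hρ hR hM hω hm (hmc θ (.inl rfl)) hα (hs θ (.inl rfl))
        (hm1 θ (.inl rfl)) (hρ _ hμ),
      rayIntegral_resolvent hρ hR hM hω hm (hmc (-θ) (.inr rfl)) hα (hs (-θ) (.inr rfl))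
        (hm1 (-θ) (.inr rfl)) (hρ _ hμ), map_smul, map_sub]
  · have h1 := (le_max_left _ _).trans hz.2.2
    have h1' := (le_max_right _ _).trans hz.2.2
    have h2 := hC' z (hsh.trans_le hz.1) h1
    have h3 := (H (z - ω) (by simp; linarith [hz.2.1]) (by simp; linarith [hz.1])).2
    have h4 := norm_resolvent_rayIntegral_sub_le hρ hR hM hω hm (hmc θ (.inl rfl)) hα
      (hs θ (.inl rfl)) (hm1 θ (.inl rfl)) (hSρ hz) (hm2 z hz θ (.inl rfl)) y
    have h5 := norm_resolvent_rayIntegral_sub_le hρ hR hM hω hm (hmc (-θ) (.inr rfl)) hα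
      (hs (-θ) (.inr rfl)) (hm1 (-θ) (.inr rfl)) (hSρ hz) (hm2 z hz (-θ) (.inr rfl)) y
    set g₁ := rayIntegral (cauchyPow α (z - ω)) θ 1
    set g₂ := rayIntegral (cauchyPow α (z - ω)) (-θ) 1
    rw [fracNegPower_of_ne_zero A ω θ hα.ne', map_smul, norm_smul, 
      mul_assoc ‖(2 * Real.pi * Complex.I : ℂ)⁻¹‖, map_sub]
    refine mul_le_mul_of_nonneg_left ?_ (norm_nonneg _)
    set I₁ := resolvent A z (∫ r in Set.Ioi (0 : ℝ), rayIntegrand A ω α θ y r)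
    set I₂ := resolvent A z (∫ r in Set.Ioi (0 : ℝ), rayIntegrand A ω α (-θ) y r)
    -- Only the difference `g₁ - g₂` of the ray integrals is known to be `O(|Im z|^{-α})`, so the
    -- terms in `R(z)y` are collected before estimating.
    have e : I₁ - I₂ = (I₁ - g₁ • resolvent A z y) - (I₂ - g₂ • resolvent A z y) +
        (g₁ - g₂) • resolvent A z y := by rw [sub_smul]; abel
    have him : (z - ω).im = z.im := by simp
    rw [him] at h3
    have h6 : ‖(g₁ - g₂) • resolvent A z y‖ ≤ K * (2 * |C|) * ‖y‖ := by
      rw [norm_smul]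
      have hz0 : 0 < |z.im| := by linarith
      have h7 : |z.im| ^ (-α) * |z.im| ^ α = 1 := by
        rw [← Real.rpow_add hz0, neg_add_cancel, Real.rpow_zero]
      calc _ ≤ K * |z.im| ^ (-α) * (2 * |C| * |z.im| ^ α * ‖y‖) :=
            mul_le_mul h3 ((resolvent A z).le_of_opNorm_le h2 y) (norm_nonneg _) (by positivity)
        _ = K * (2 * |C|) * ‖y‖ * (|z.im| ^ (-α) * |z.im| ^ α) := by ring
        _ = _ := by rw [h7, mul_one]
    rw [e]
    calc _ ≤ _ := norm_add_le _ _
      _ ≤ _ := add_le_add (norm_sub_le _ _) h6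
      _ ≤ _ := add_le_add_left (add_le_add h4 h5) _
      _ = _ := by ring

end UnboundedOperator

/-! ### Moving the line of integration for Cesàro means. -/

section Cesaro

variable {X : Type*} [NormedAddCommGroup X]

theorem tendsto_integral_mean_zero [NormedSpace ℝ X] {E : ℝ → X} (hE : Continuous E)
    (h0 : Tendsto E atTop (𝓝 0)) :
    Tendsto (fun N : ℝ => N⁻¹ • ∫ l in (0 : ℝ)..N, E l) atTop (𝓝 0) := by
  rw [Metric.tendsto_atTop]
  intro ε hε
  obtain ⟨B₀, hB₀⟩ := Metric.tendsto_atTop.1 h0 (ε / 2) (half_pos hε)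
  set B := max B₀ 0
  set D := ‖∫ l in (0 : ℝ)..B, E l‖ with hD
  refine ⟨max B (2 * D / ε) + 1, fun N hN => ?_⟩
  have hNB : B ≤ N := by linarith [le_max_left B (2 * D / ε)]
  have hND : 2 * D / ε < N := by linarith [le_max_right B (2 * D / ε)]
  have hB : 0 ≤ B := le_max_right _ _
  have hN0 : 0 < N := by linarith [le_max_left B (2 * D / ε)]
  rw [dist_zero_right, norm_smul, norm_inv, Real.norm_of_nonneg hN0.le,
    ← intervalIntegral.integral_add_adjacent_intervals (hE.intervalIntegrable 0 B)
      (hE.intervalIntegrable B N), inv_mul_lt_iff₀ hN0]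
  have h1 : ‖∫ l in B..N, E l‖ ≤ ε / 2 * |N - B| := by
    refine intervalIntegral.norm_integral_le_of_norm_le_const fun l hl => ?_
    rw [Set.uIoc_of_le hNB] at hl
    have := hB₀ l ((le_max_left _ _).trans hl.1.le)
    rw [dist_zero_right] at this
    exact this.le
  rw [abs_of_nonneg (by linarith)] at h1
  rw [div_lt_iff₀ hε] at hND
  calc _ ≤ D + ε / 2 * (N - B) := (norm_add_le _ _).trans (add_le_add_right h1 _)
    _ < N * ε := by nlinarith

theorem continuous_symm_intervalIntegral [NormedSpace ℝ X] {G : ℝ → X} (hG : Continuous G) :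
    Continuous fun l : ℝ => ∫ s in (-l)..l, G s := by
  have h1 : Continuous fun l : ℝ => ∫ s in (0 : ℝ)..l, G s :=
    intervalIntegral.continuous_primitive (fun a b => hG.intervalIntegrable a b) 0
  have h2 : (fun l : ℝ => ∫ s in (-l)..l, G s) = fun l : ℝ =>
      (∫ s in (0 : ℝ)..l, G s) - ∫ s in (0 : ℝ)..(-l), G s := by
    ext l
    exact (intervalIntegral.integral_interval_sub_left (hG.intervalIntegrable _ _)
      (hG.intervalIntegrable _ _)).symm
  rw [h2]
  exact h1.sub (h1.comp continuous_neg)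

variable [NormedSpace ℂ X]

/-- Cauchy's theorem for Cesàro means of vertical line integrals. -/
theorem tendsto_cesaro_line_shift {g : ℂ → X} {s h h₁ : ℝ} (hsh : s < h)
    (hh : h ≤ h₁) (hg : DifferentiableOn ℂ g {z | s < z.re})
    (hdecay : ∀ ε : ℝ, 0 < ε → ∃ B : ℝ, ∀ z : ℂ, h ≤ z.re → z.re ≤ h₁ → B ≤ |z.im| → ‖g z‖ ≤ ε)
    {J : X} (hJ : Tendsto (fun N : ℝ => N⁻¹ • ∫ l in (0 : ℝ)..N, ∫ y in (-l)..l,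
      Complex.I • g (h₁ + y * Complex.I)) atTop (𝓝 J)) :
    Tendsto (fun N : ℝ => N⁻¹ • ∫ l in (0 : ℝ)..N, ∫ y in (-l)..l,
      Complex.I • g (h + y * Complex.I)) atTop (𝓝 J) := by
  have hline : ∀ a : ℝ, s < a → Continuous fun y : ℝ => Complex.I • g (a + y * Complex.I) := by
    intro a ha
    refine continuous_const.smul (hg.continuousOn.comp_continuous (by fun_prop) fun y => ?_)
    simpa using ha
  set V : ℝ → ℝ → X := fun a l => ∫ y in (-l)..l, Complex.I • g (a + y * Complex.I) with hV
  have hVc : ∀ a : ℝ, s < a → Continuous (V a) := fun a ha =>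
    continuous_symm_intervalIntegral (hline a ha)
  have hrect : ∀ l : ℝ, V h l - V h₁ l = (∫ a in h..h₁, g (a + (-l : ℝ) * Complex.I)) -
      ∫ a in h..h₁, g (a + l * Complex.I) := by
    intro l
    have := Complex.integral_boundary_rect_eq_zero_of_differentiableOn g
      (h + (-l : ℝ) * Complex.I) (h₁ + l * Complex.I) (hg.mono fun z hz => by
        have h1 := (Complex.mem_reProdIm.1 hz).1
        simp only [Complex.add_re, Complex.ofReal_re, Complex.re_ofReal_mul, Complex.I_re,
          mul_zero, add_zero] at h1
        rw [Set.uIcc_of_le hh] at h1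
        exact hsh.trans_le h1.1)
    simp only [Complex.add_re, Complex.ofReal_re, Complex.re_ofReal_mul, Complex.I_re, mul_zero,
      add_zero, Complex.add_im, Complex.ofReal_im, Complex.im_ofReal_mul, Complex.I_im, mul_one,
      zero_add] at this
    simp only [hV, intervalIntegral.integral_smul]
    rw [← sub_eq_zero, ← neg_eq_zero, ← this]
    abel
  -- The truncated integrals over the two lines differ by the horizontal sides, of fixed length `h₁
  -- - h`; a difference tending to `0` has Cesàro means tending to `0`.
  have hlim : Tendsto (fun l => V h l - V h₁ l) atTop (𝓝 0) := by
    rw [Metric.tendsto_atTop]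
    intro ε hε
    obtain ⟨B, hB⟩ := hdecay (ε / (2 * (h₁ - h) + 1)) (by
      have : 0 ≤ h₁ - h := by linarith
      positivity)
    have hpos : 0 < 2 * (h₁ - h) + 1 := by linarith
    refine ⟨B, fun l hl => ?_⟩
    have hside : ∀ y : ℝ, |y| = |l| → ‖∫ a in h..h₁, g (a + y * Complex.I)‖ ≤
        ε / (2 * (h₁ - h) + 1) * (h₁ - h) := by
      intro y hy
      have := intervalIntegral.norm_integral_le_of_norm_le_const (a := h) (b := h₁)
        (f := fun a : ℝ => g (a + y * Complex.I)) (C := ε / (2 * (h₁ - h) + 1)) fun a ha => by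
          rw [Set.uIoc_of_le hh] at ha
          refine hB _ (by simpa using ha.1.le) (by simpa using ha.2) ?_
          simp only [Complex.add_im, Complex.ofReal_im, Complex.im_ofReal_mul, Complex.I_im,
            mul_one, zero_add]
          rw [hy]
          exact hl.trans (le_abs_self l)
      rwa [abs_of_nonneg (by linarith : 0 ≤ h₁ - h)] at this
    rw [dist_zero_right, hrect]
    refine (norm_sub_le _ _).trans_lt ((add_le_add (hside (-l) (abs_neg l))
      (hside l rfl)).trans_lt ?_)
    rw [← mul_add, div_mul_eq_mul_div, div_lt_iff₀ hpos]
    nlinarith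
  have hmean := tendsto_integral_mean_zero ((hVc h hsh).sub (hVc h₁ (hsh.trans_le hh))) hlim
  have hsum := hJ.add hmean
  rw [add_zero] at hsum
  refine hsum.congr fun N => ?_
  have hsub : ∫ l in (0 : ℝ)..N, (V h - V h₁) l =
      (∫ l in (0 : ℝ)..N, V h l) - ∫ l in (0 : ℝ)..N, V h₁ l :=
    intervalIntegral.integral_sub ((hVc h hsh).intervalIntegrable _ _)
      ((hVc h₁ (hsh.trans_le hh)).intervalIntegrable _ _)
  rw [← smul_add, hsub, add_sub_cancel]

end Cesaro

theorem UnboundedOperator.exists_of_resolventAbscissa_lt {X : Type*} [NormedAddCommGroup X]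
    [NormedSpace ℂ X] {A : X →ₗ.[ℂ] X} {α h : ℝ} (hh : resolventAbscissa A α < (h : EReal)) :
    ∃ s C : ℝ, s < h ∧ (∀ z : ℂ, s < z.re → z ∈ resolventSet A) ∧
      ∀ z : ℂ, s < z.re → ‖resolvent A z‖ / (1 + |z.im| ^ α) ≤ C := by
  obtain ⟨_, ⟨s, ⟨hs, C, hC⟩, rfl⟩, hlt⟩ := sInf_lt_iff.1 hh
  exact ⟨s, C, EReal.coe_lt_coe_iff.1 hlt, hs, hC⟩

/-- For `α ≥ 0` the majorant `C(1 + |Im z|^α)` is continuous, so the growth condition supplies the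
local bounds that holomorphy needs. -/
theorem UnboundedOperator.differentiableOn_resolvent_of_growth {X : Type*} [NormedAddCommGroup X]
    [NormedSpace ℂ X] {A : X →ₗ.[ℂ] X} {α s C : ℝ} (hα : 0 ≤ α)
    (hs : ∀ z : ℂ, s < z.re → z ∈ resolventSet A)
    (hC : ∀ z : ℂ, s < z.re → ‖resolvent A z‖ / (1 + |z.im| ^ α) ≤ C) (x : X) :
    DifferentiableOn ℂ (fun z => resolvent A z x) {z | s < z.re} := by
  have hopen : IsOpen {z : ℂ | s < z.re} := isOpen_lt continuous_const Complex.continuous_re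
  refine differentiableOn_resolvent_apply hopen hs (fun z hz => ?_) x
  have hcont : ContinuousAt (fun u : ℂ => C * (1 + |u.im| ^ α)) z := by
    have h1 : Continuous fun u : ℂ => |u.im| ^ α :=
      (continuous_abs.comp Complex.continuous_im).rpow_const fun _ => .inr hα
    exact (continuous_const.mul (continuous_const.add h1)).continuousAt
  refine ⟨C * (1 + |z.im| ^ α) + 1, ?_⟩
  filter_upwards [hcont.eventually_le_const (lt_add_one _), hopen.mem_nhds hz] with u hu hus
  have h1 := hC u hus
  rw [div_le_iff₀ (by positivity)] at h1
  exact h1.trans hu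

theorem corollary3p5 {X : Type*} [NormedAddCommGroup X] [NormedSpace ℂ X] [CompleteSpace X]
    (T : C0Semigroup X) (α : ℝ) (hα : 0 ≤ α)
    (ω θ : ℝ) (hω₀ : T.growthBound + 3 < (ω : EReal)) (hω : 3 < ω)
    (hθ₀ : 0 < θ) (hθ : θ < Real.pi / 6)
    (x : X) (hx : x ∈ UnboundedOperator.fracDomain T.generator ω θ α)
    (h : ℝ) (hh : UnboundedOperator.resolventAbscissa T.generator α < (h : EReal)) :
    ∀ t : ℝ, ∃ J : X,
      HasCesaroLineIntegral
        (fun z : ℂ => Complex.exp (z * t) • UnboundedOperator.resolvent T.generator z x) h J ∧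
      T.extendedOrbit t x = (1 / (2 * Real.pi * Complex.I)) • J := by
  intro t
  obtain ⟨w, M, hw, hM⟩ := C0Semigroup.exists_bound_of_growthBound_add_lt (c := 3) hω₀
  obtain ⟨s, C, hsh, hs, hC⟩ := UnboundedOperator.exists_of_resolventAbscissa_lt hh
  have hdiff : DifferentiableOn ℂ
      (fun z : ℂ => Complex.exp (z * t) • UnboundedOperator.resolvent T.generator z x)
      {z | s < z.re} :=
    DifferentiableOn.smul (by fun_prop)
      (UnboundedOperator.differentiableOn_resolvent_of_growth hα hs hC x)
  refine ⟨(2 * Real.pi * Complex.I) • T.extendedOrbit t x, ⟨fun l => ?_, ?_⟩, ?_⟩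
  · refine Continuous.intervalIntegrable ?_ _ _
    refine hdiff.continuousOn.comp_continuous (by fun_prop) fun y => ?_
    simpa using hsh
  -- Since `w + 3 < ω`, the line `Re z = ω - 2` lies in the region of Laplace inversion; only lines
  -- to its left need the shift.
  · rcases le_or_gt (ω - 2) h with hcase | hcase
    · exact C0Semigroup.tendsto_cesaro_resolvent hM (by linarith) t x
    · refine tendsto_cesaro_line_shift hsh hcase.le hdiff (fun ε hε => ?_)
        (C0Semigroup.tendsto_cesaro_resolvent hM (by linarith) t x)
      -- `b` bounds `|e^{zt}|` on the strip, so decay of the resolvent is requested at level `ε /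
      -- b`.
      set b := Real.exp (max |h| |ω - 2| * |t|) with hb
      obtain ⟨B, hB⟩ := UnboundedOperator.exists_norm_resolvent_le_of_mem_fracDomain
        (A := T.generator) (M := M) (w := w)
        (fun u hu => ⟨_, C0Semigroup.isResolventAt_laplace hM hu⟩)
        (fun u hu => by
          rw [(C0Semigroup.isResolventAt_laplace hM hu).resolvent_eq]
          exact C0Semigroup.norm_laplace_le hM hu)
        (C0Semigroup.bound_nonneg hM) hw
        (fun u hu => by
          rw [(C0Semigroup.isResolventAt_laplace hM hu).resolvent_eq]
          exact C0Semigroup.denseRange_laplace hM hu)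
        hθ₀ hθ hα hsh hs hC hx (div_pos hε (Real.exp_pos _) : 0 < ε / b)
      refine ⟨B, fun z h1 h2 h3 => ?_⟩
      have h4 : ‖Complex.exp (z * t)‖ ≤ b := by
        rw [Complex.norm_exp, Complex.re_mul_ofReal, hb]
        refine Real.exp_le_exp.2 ((le_abs_self _).trans ?_)
        rw [abs_mul]
        gcongr
        exact abs_le_max_abs_abs h1 h2
      rw [norm_smul]
      calc _ ≤ b * (ε / b) :=
            mul_le_mul h4 (hB z h1 h2 h3) (norm_nonneg _) (Real.exp_pos _).le
        _ = ε := by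
          have : b ≠ 0 := (Real.exp_pos _).ne'
          field_simp
  · rw [smul_smul, one_div, inv_mul_cancel₀ Complex.two_pi_I_ne_zero, one_smul]
end
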